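/- Let $p\ge 1$ and let $\boldsymbol\beta=(\beta_0,\dots,\beta_{p-1})$ be real numbers greater than $1$, extended by $\beta_n=\beta_{n\bmod p}$; let $\boldsymbol\beta^{(i)}=(\beta_i,\dots,\beta_{i+p-1})$, $\delta=\prod_{i=0}^{p-1}\beta_i$ and $\mathrm{val}_{\boldsymbol\beta}(a)=\sum_{n\ge 0}a_n/\prod_{k=0}^n\beta_k$. The $\boldsymbol\beta$-expansion $d_{\boldsymbol\beta}(x)=\varepsilon_0\varepsilon_1\cdots$ of $x\in[0,1)$ is given by the greedy algorithm $r_{-1}=x$, $\varepsilon_n=\lfloor\beta_n r_{n-1}\rfloor$, $r_n=\beta_n r_{n-1}-\varepsilon_n$, and $d^*_{\boldsymbol\beta}(1)=\lim_{x\to1^-}d_{\boldsymbol\beta}(x)$ in the product topology. Let $\boldsymbol D=(D_0,\dots,D_{p-1})$ be any tuple of finite sets of integers, $D_n=D_{n\bmod p}$, and let $D'_n=\{0,\dots,\lceil\beta_n\rceil-1\}$. The normalization function $\nu_{\boldsymbol\beta,\boldsymbol D}$ is the partial function that maps each $a\in\prod_n D_n$ with $x=\mathrm{val}_{\boldsymbol\beta}(a)\in[0,1)$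 to $d_{\boldsymbol\beta}(x)$. It is computable by a finite Büchi automaton if a finite Büchi automaton (finitely many states, finite alphabet) accepts $$N=\Big\{(u,v)\in\prod_n(D_n\times D'_n):\ \mathrm{val}_{\boldsymbol\beta}(u)=\mathrm{val}_{\boldsymbol\beta}(v),\ \exists x\in[0,1)\ v=d_{\boldsymbol\beta}(x)\Big\}.$$ **Theorem.** Suppose that $\delta$ is a Pisot number (an algebraic integer $>1$ all of whose other conjugates have modulus $<1$) and that $\beta_i\in\mathbb Q(\delta)$ for all $i$. Then $N$ is the graph of $\nu_{\boldsymbol\beta,\boldsymbol D}$, and $\nu_{\boldsymbol\beta,\boldsymbol D}$ is computable by a finite Büchi automaton. Explicitly: 1. For each $i$ the limit $t^{(i)}=d^*_{\boldsymbol\beta^{(i)}}(1)$ exists and is eventually periodic. For any choice of preperiods $m_i\ge1$ and periods $n_i\ge1$ of the $t^{(i)}$, let $\mathcal B$ be the finite Büchi automaton with states $(i,j,k)$, $0\le i,j<p$, $0\le k<m_i+n_i$, initial state $(0,0,0)$, final states $(i,i,0)$, and, from $(i,j,k)$, a transition labelled $t^{(i)}_k$ to $(i,j+1\bmod p,k')$,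 where $k'=k+1$ if $k+1<m_i+n_i$ and $k'=m_i$ otherwise, and, for each integer $0\le s<t_k^{(i)}$, a transition labelled $s$ to $(j+1\bmod p,j+1\bmod p,0)$. Then $\mathcal B$ accepts $\{d_{\boldsymbol\beta}(x):x\in[0,1)\}$. Let $\mathcal B_2$ be the automaton with the same states, initial state and final states as $\mathcal B$, with a transition labelled $(a,b)$ from $(i,j,k)$ whenever $a\in D_j$, $b\in D'_j$ and $\mathcal B$ has the corresponding transition labelled $b$. It is finite and accepts $\{(u,v)\in\prod_n(D_n\times D'_n):\exists x\in[0,1)\ v=d_{\boldsymbol\beta}(x)\}$. 2. Suppose moreover that $0\in D_i$ for all $i$. Put $E_i=D_i-D'_i$, extended periodically, and let $X(i)$ be the set of all $\sum_{n=0}^{\ell-1}c_n\delta^{\ell-1-n}$ with $\ell\ge0$ and each $c_n$ of the form $\sum_{h=0}^{p-1}e_h\beta_{i+h+1}\cdots\beta_{i+p-1}$, $e_h\in E_{i+h}$. Let $M^{(i)}=\sum_{n\ge i}\max E_n/\prod_{k=i}^n\beta_k$ and $m^{(i)}=\sum_{n\ge i}\min E_n/\prod_{k=i}^n\beta_k$.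 The zero automaton over $(E_0,\dots,E_{p-1})$ has states $(i,s)$ with $0\le i<p$ and $s\in X(i)\cap[-M^{(i)},-m^{(i)}]$, all of them final, initial state $(0,0)$, and transitions $(i,s)\to(i+1\bmod p,\ \beta_is+e)$ labelled $e\in E_i$. The converter $\mathcal C$ has the same states, initial state and final states, and a transition labelled $(a,b)\in D_i\times D'_i$ from $(i,s)$ to $(j,t)$ whenever the zero automaton has one labelled $a-b$. Then $\mathcal C$ is finite and accepts $\{(u,v)\in\prod_n(D_n\times D'_n):\mathrm{val}_{\boldsymbol\beta}(u)=\mathrm{val}_{\boldsymbol\beta}(v)\}$, and the intersection (product) Büchi automaton of $\mathcal C$ and $\mathcal B_2$ is finite and accepts exactly $N$, so it computes $\nu_{\boldsymbol\beta,\boldsymbol D}$. -/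

import Mathlib

noncomputable section

namespace AlternateBase

/-! ### Pisot numbers -/

/-- A real algebraic integer greater than `1` all of whose other Galois conjugates (complex roots of
its minimal polynomial over `ℚ`) have modulus less than `1`. -/
def IsPisot (δ : ℝ) : Prop :=
  IsIntegral ℤ δ ∧ 1 < δ ∧
    ∀ z : ℂ, Polynomial.aeval z (minpoly ℚ δ) = 0 → z ≠ (δ : ℂ) → ‖z‖ < 1

/-! ### Büchi automata -/

/-- An automaton `(Q, I, F, A, E)` with letters taken from `α` and states taken from `σ`. -/
structure BuchiAutomaton (α σ : Type) where
  states : Set σ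
  init : Set σ
  final : Set σ
  alphabet : Set α
  trans : Set (σ × α × σ)
  init_subset : init ⊆ states
  final_subset : final ⊆ states
  trans_mem : ∀ q a q', (q, a, q') ∈ trans → q ∈ states ∧ a ∈ alphabet ∧ q' ∈ states

namespace BuchiAutomaton

variable {α σ τ : Type}

/-- Finitely many states (and a finite alphabet). -/
def IsFinite (M : BuchiAutomaton α σ) : Prop := M.states.Finite ∧ M.alphabet.Finite

/-- The set of infinite words accepted by `M`: those labelling an initial path that goes infinitely
many times through a final state. -/
def language (M : BuchiAutomaton α σ) : Set (ℕ → α) :=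
  {w | ∃ q : ℕ → σ, q 0 ∈ M.init ∧ (∀ n, (q n, w n, q (n + 1)) ∈ M.trans) ∧
    ∃ᶠ n in Filter.atTop, q n ∈ M.final}

/-- The intersection of two Büchi automata: the product automaton with a flag. The flag is `false`
while waiting for a final state of `M`, and `true` while waiting for a final state of `N`. -/
def inter (M : BuchiAutomaton α σ) (N : BuchiAutomaton α τ) :
    BuchiAutomaton α (σ × τ × Bool) where
  states := {q | q.1 ∈ M.states ∧ q.2.1 ∈ N.states}
  init := {q | q.1 ∈ M.init ∧ q.2.1 ∈ N.init ∧ q.2.2 = false}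
  final := {q | q.1 ∈ M.final ∧ q.2.1 ∈ N.states ∧ q.2.2 = false}
  alphabet := M.alphabet ∩ N.alphabet
  trans := {e | (e.1.1, e.2.1, e.2.2.1) ∈ M.trans ∧ (e.1.2.1, e.2.1, e.2.2.2.1) ∈ N.trans ∧
    (e.2.2.2.2 = true ↔
      (e.1.2.2 = false ∧ e.1.1 ∈ M.final) ∨ (e.1.2.2 = true ∧ e.1.2.1 ∉ N.final))}
  init_subset := fun _ hq => ⟨M.init_subset hq.1, N.init_subset hq.2.1⟩
  final_subset := fun _ hq => ⟨M.final_subset hq.1, hq.2.1⟩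
  trans_mem := fun _ _ _ h =>
    have h1 := M.trans_mem _ _ _ h.1
    have h2 := N.trans_mem _ _ _ h.2.1
    ⟨⟨h1.1, h2.1⟩, ⟨h1.2.1, h2.2.1⟩, ⟨h1.2.2, h2.2.2⟩⟩

end BuchiAutomaton

/-! ### Alternate bases, values and greedy expansions -/

variable {p : ℕ} [NeZero p]

/-- The `p`-periodic extension `x_n = x_{n mod p}` of a `p`-tuple `x`. -/
def cyc {X : Type} (x : Fin p → X) (n : ℕ) : X := x (Fin.ofNat p n)

/-- The cyclic shift `x^{(i)} = (x_i, …, x_{i+p-1})` of a `p`-tuple `x`. -/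
def shift {X : Type} (x : Fin p → X) (i : Fin p) : Fin p → X := fun j => x (j + i)

/-- The value `∑_n a_n / (β_0 ⋯ β_n)` of a sequence of integers in base `β`. -/
def val (β : Fin p → ℝ) (a : ℕ → ℤ) : ℝ :=
  ∑' n, (a n : ℝ) / ∏ k ∈ Finset.range (n + 1), cyc β k

/-- Remainders of the greedy algorithm; `rem β x n` is `r_{n-1}(x)`, with `r_{-1}(x) = x`. -/
def rem (β : Fin p → ℝ) (x : ℝ) : ℕ → ℝ
  | 0 => x
  | n + 1 => cyc β n * rem β x n - (⌊cyc β n * rem β x n⌋ : ℝ)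

/-- The `β`-expansion `d_β(x)` produced by the greedy algorithm. -/
def greedy (β : Fin p → ℝ) (x : ℝ) (n : ℕ) : ℤ := ⌊cyc β n * rem β x n⌋

/-- `t` is the quasi-greedy `β`-expansion of `1`: the limit of the `β`-expansions of `x` as `x`
tends to `1` from below, in the product topology of infinite words (`ℤ` being discrete). -/
def IsQuasiGreedy (β : Fin p → ℝ) (t : ℕ → ℤ) : Prop :=
  Filter.Tendsto (fun x : ℝ => greedy β x) (nhdsWithin 1 (Set.Iio 1)) (nhds t)

/-- `t = t_0 ⋯ t_{m-1} (t_m ⋯ t_{m+n-1})^ω` with non-empty preperiod and period. -/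
def HasPeriod (t : ℕ → ℤ) (m n : ℕ) : Prop :=
  1 ≤ m ∧ 1 ≤ n ∧ ∀ k, m ≤ k → t (k + n) = t k

/-- The tuple of alphabets `{0, …, ⌈β_i⌉ - 1}`. -/
def greedyAlphabet (β : Fin p → ℝ) : Fin p → Finset ℤ := fun i => Finset.Icc 0 (⌈β i⌉ - 1)

/-! ### The normalization function -/

/-- The set of pairs `(u, v)` with `u_n ∈ D_n`, `v_n ∈ D'_n`, as words over pairs. -/
def pairWords (D D' : Fin p → Finset ℤ) : Set (ℕ → ℤ × ℤ) :=
  {w | ∀ n, (w n).1 ∈ cyc D n ∧ (w n).2 ∈ cyc D' n}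

/-- The normalization function: the partial function that maps a `β`-representation, with digits
`a_n ∈ D_n`, of a number `x ∈ [0,1)` to the `β`-expansion of `x`. -/
def normalization (β : Fin p → ℝ) (D : Fin p → Finset ℤ) : (ℕ → ℤ) →. (ℕ → ℤ) := fun a =>
  ⟨(∀ n, a n ∈ cyc D n) ∧ val β a ∈ Set.Ico (0 : ℝ) 1, fun _ => greedy β (val β a)⟩

/-- The set of pairs of words that an automaton computing the normalization has to accept. -/
def normalizationPairs (β : Fin p → ℝ) (D : Fin p → Finset ℤ) : Set (ℕ → ℤ × ℤ) :=
  {w | w ∈ pairWords D (greedyAlphabet β) ∧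
    val β (fun n => (w n).1) = val β (fun n => (w n).2) ∧
    ∃ x ∈ Set.Ico (0 : ℝ) 1, (fun n => (w n).2) = greedy β x}

/-- The normalization function is computable by a finite Büchi automaton. -/
def NormalizationComputable (β : Fin p → ℝ) (D : Fin p → Finset ℤ) : Prop :=
  ∃ (σ : Type) (M : BuchiAutomaton (ℤ × ℤ) σ), M.IsFinite ∧ M.language = normalizationPairs β D

/-! ### Spectrum, zero automaton and converter -/

/-- The spectrum of `δ` over the alphabet `A`: values `∑_{n<ℓ} a_n δ^{ℓ-1-n}` of words over `A`. -/
def spectrum (δ : ℝ) (A : Set ℝ) : Set ℝ :=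
  {x | ∃ (ℓ : ℕ) (a : ℕ → ℝ), (∀ n < ℓ, a n ∈ A) ∧
    x = ∑ n ∈ Finset.range ℓ, a n * δ ^ (ℓ - 1 - n)}

/-- The real alphabet of all `∑_i a_i β_{i+1} ⋯ β_{p-1}` with `a_i ∈ D_i`. -/
def blockDigits (β : Fin p → ℝ) (D : Fin p → Finset ℤ) : Set ℝ :=
  {x | ∃ a : Fin p → ℤ, (∀ i, a i ∈ D i) ∧ x = ∑ i, (a i : ℝ) * ∏ k ∈ Finset.Ioi i, β k}

/-- The spectrum `X(i)` built from the `i`-th cyclic shifts of the base and the alphabets. -/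
def altSpectrum (β : Fin p → ℝ) (D : Fin p → Finset ℤ) (i : Fin p) : Set ℝ :=
  spectrum (∏ k, β k) (blockDigits (shift β i) (shift D i))

/-- Largest digit of an alphabet (`0` for the empty alphabet). -/
def maxDigit (A : Finset ℤ) : ℤ := A.max.unbotD 0

/-- Smallest digit of an alphabet (`0` for the empty alphabet). -/
def minDigit (A : Finset ℤ) : ℤ := A.min.untopD 0

/-- `M^{(i)} = ∑_{n ≥ i} max(D_n) / (β_i ⋯ β_n)`. -/
def upper (β : Fin p → ℝ) (D : Fin p → Finset ℤ) (i : Fin p) : ℝ :=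
  val (shift β i) (fun n => maxDigit (cyc (shift D i) n))

/-- `m^{(i)} = ∑_{n ≥ i} min(D_n) / (β_i ⋯ β_n)`. -/
def lower (β : Fin p → ℝ) (D : Fin p → Finset ℤ) (i : Fin p) : ℝ :=
  val (shift β i) (fun n => minDigit (cyc (shift D i) n))

/-- The zero automaton: states `(i, s)` with `s ∈ X(i) ∩ [-M^{(i)}, -m^{(i)}]`, initial state
`(0, 0)`, all states final, transitions `(i, s) → (i + 1, β_i s + a)` labelled by `a ∈ D_i`. (The
state `(0, 0)` belongs to the state set as soon as every `D_i` contains `0`.) -/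
def zeroAutomaton (β : Fin p → ℝ) (D : Fin p → Finset ℤ) : BuchiAutomaton ℤ (Fin p × ℝ) where
  states := {q | q.2 ∈ altSpectrum β D q.1 ∩ Set.Icc (-upper β D q.1) (-lower β D q.1)}
  init := {q | q = (0, 0) ∧
    q.2 ∈ altSpectrum β D q.1 ∩ Set.Icc (-upper β D q.1) (-lower β D q.1)}
  final := {q | q.2 ∈ altSpectrum β D q.1 ∩ Set.Icc (-upper β D q.1) (-lower β D q.1)}
  alphabet := {a | ∃ i, a ∈ D i}
  trans := {e |
    e.1.2 ∈ altSpectrum β D e.1.1 ∩ Set.Icc (-upper β D e.1.1) (-lower β D e.1.1) ∧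
    e.2.2.2 ∈ altSpectrum β D e.2.2.1 ∩ Set.Icc (-upper β D e.2.2.1) (-lower β D e.2.2.1) ∧
    e.2.1 ∈ D e.1.1 ∧ e.2.2.1 = e.1.1 + 1 ∧ e.2.2.2 = β e.1.1 * e.1.2 + (e.2.1 : ℝ)}
  init_subset := fun _ h => h.2
  final_subset := fun _ h => h
  trans_mem := fun q _ _ h => ⟨h.1, ⟨q.1, h.2.2.1⟩, h.2.1⟩

/-- The tuple `(D_0 - D'_0, …, D_{p-1} - D'_{p-1})` of alphabets of differences. -/
def diffAlphabet (D D' : Fin p → Finset ℤ) : Fin p → Finset ℤ :=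
  fun i => Finset.image₂ (fun a b => a - b) (D i) (D' i)

/-- The converter from `D` to `D'`: same states as the zero automaton over `D - D'`, with a
transition `(i, s) → (j, t)` labelled by `(a, b) ∈ D_i × D'_i` whenever the zero automaton has a
transition `(i, s) → (j, t)` labelled by `a - b`. -/
def converter (β : Fin p → ℝ) (D D' : Fin p → Finset ℤ) :
    BuchiAutomaton (ℤ × ℤ) (Fin p × ℝ) where
  states := (zeroAutomaton β (diffAlphabet D D')).states
  init := (zeroAutomaton β (diffAlphabet D D')).init
  final := (zeroAutomaton β (diffAlphabet D D')).final
  alphabet := {c | ∃ i, c.1 ∈ D i ∧ c.2 ∈ D' i}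
  trans := {e | e.2.1.1 ∈ D e.1.1 ∧ e.2.1.2 ∈ D' e.1.1 ∧
    (e.1, e.2.1.1 - e.2.1.2, e.2.2) ∈ (zeroAutomaton β (diffAlphabet D D')).trans}
  init_subset := (zeroAutomaton β (diffAlphabet D D')).init_subset
  final_subset := (zeroAutomaton β (diffAlphabet D D')).final_subset
  trans_mem := fun q _ _ h =>
    have h' := (zeroAutomaton β (diffAlphabet D D')).trans_mem _ _ _ h.2.2
    ⟨h'.1, ⟨q.1, h.1, h.2.1⟩, h'.2.2⟩

/-! ### The automaton of greedy expansions -/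

/-- The successor of the state `(i, j, k)` on reading the digit `t^{(i)}_k` itself. -/
def advance (m n : Fin p → ℕ) (q : Fin p × Fin p × ℕ) : Fin p × Fin p × ℕ :=
  (q.1, q.2.1 + 1, if q.2.2 + 1 < m q.1 + n q.1 then q.2.2 + 1 else m q.1)

/-- The Büchi automaton built from words `t^{(i)}` with preperiods `m_i` and periods `n_i`: states
`(i, j, k)` with `k < m_i + n_i`, initial state `(0, 0, 0)`, final states `(i, i, 0)`. From
`(i, j, k)`, the digit `t^{(i)}_k` leads to the next position of the word `t^{(i)}`, and each digit
`0 ≤ s < t^{(i)}_k` leads to `(j + 1, j + 1, 0)`. (If all `m_i` and `n_i` are positive, the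
conditions restricting everything to the state set are automatic.) -/
def greedyAutomaton (β : Fin p → ℝ) (t : Fin p → ℕ → ℤ) (m n : Fin p → ℕ) :
    BuchiAutomaton ℤ (Fin p × Fin p × ℕ) where
  states := {q | q.2.2 < m q.1 + n q.1}
  init := {q | q = (0, 0, 0) ∧ q.2.2 < m q.1 + n q.1}
  final := {q | (q.1 = q.2.1 ∧ q.2.2 = 0) ∧ q.2.2 < m q.1 + n q.1}
  alphabet := {a | ∃ i, a ∈ greedyAlphabet β i}
  trans := {e | e.1.2.2 < m e.1.1 + n e.1.1 ∧ (∃ i, e.2.1 ∈ greedyAlphabet β i) ∧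
    e.2.2.2.2 < m e.2.2.1 + n e.2.2.1 ∧
    ((e.2.1 = t e.1.1 e.1.2.2 ∧ e.2.2 = advance m n e.1) ∨
      (e.2.1 < t e.1.1 e.1.2.2 ∧ e.2.2 = (e.1.2.1 + 1, e.1.2.1 + 1, 0)))}
  init_subset := fun _ h => h.2
  final_subset := fun _ h => h.2
  trans_mem := fun _ _ _ h => ⟨h.1, h.2.1, h.2.2.1⟩

/-- The automaton over pairs that reads `(u, v)` with `u_n ∈ D_n` and `v_n ∈ {0, …, ⌈β_n⌉ - 1}` and
runs the automaton of greedy expansions on `v`; the second component of a state is the position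
modulo `p`. -/
def greedyPairAutomaton (β : Fin p → ℝ) (D : Fin p → Finset ℤ) (t : Fin p → ℕ → ℤ)
    (m n : Fin p → ℕ) : BuchiAutomaton (ℤ × ℤ) (Fin p × Fin p × ℕ) where
  states := (greedyAutomaton β t m n).states
  init := (greedyAutomaton β t m n).init
  final := (greedyAutomaton β t m n).final
  alphabet := {c | ∃ i, c.1 ∈ D i ∧ c.2 ∈ greedyAlphabet β i}
  trans := {e | e.2.1.1 ∈ D e.1.2.1 ∧ e.2.1.2 ∈ greedyAlphabet β e.1.2.1 ∧
    (e.1, e.2.1.2, e.2.2) ∈ (greedyAutomaton β t m n).trans}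
  init_subset := (greedyAutomaton β t m n).init_subset
  final_subset := (greedyAutomaton β t m n).final_subset
  trans_mem := fun q _ _ h =>
    have h' := (greedyAutomaton β t m n).trans_mem _ _ _ h.2.2
    ⟨h'.1, ⟨q.2.1, h.1, h.2.1⟩, h'.2.2⟩

end AlternateBase

end

namespace AlternateBase

open IntermediateField

/-! ### Finiteness of bounded parts of the spectrum -/

/-! A pair `(u, v)` lies in the graph exactly when `u - v` has value zero and `v` is a greedy
expansion. Each condition is recognized by its own automaton, and `language_inter` combines the two.

Value zero: the Horner sums of `e = u - v` are the negatives of the tail values of `e` when the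
total value is zero (`horner_eq_neg_tail`), hence stay in fixed intervals. Conversely, bounded
Horner sums force the value to be zero (`cantorVal_eq_of_remainders`). So a run of the converter
only has to remember the residue of the position and the current Horner sum. Grouping digits into
blocks of length `p` turns the alternate base into the single base `δ` with finitely many digits in
`ℚ(δ)`, so these sums lie in a spectrum of `δ`.

The Pisot property enters through `finite_spectrum_inter`. Up to a common denominator, spectrum
points are algebraic integers; at every conjugate of `δ` other than `δ` they are bounded by a
geometric series, and at `δ` itself by assumption. A number field contains only finitely many such
integers. This makes the converter finite. It also makes the quasi-greedy remainders of 1 at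
multiples of `p` range over a finite set, so the quasi-greedy expansions are eventually periodic
(`exists_hasPeriod_qdig`).

Greediness: a Parry-type condition. Compare `v` with the quasi-greedy expansion of 1 in the current
shifted base, and restart the comparison after each mismatch. Then `v` is greedy iff no digit
exceeds its pivot and mismatches recur forever (`greedy_le_pivot`, `frequently_greedy_ne_pivot`,
`tail_lt_pivotRem`). Periodicity lets finitely many states carry out this comparison, the Büchi
condition expressing the recurrence of mismatches. -/

theorem zero_mem_spectrum (δ : ℝ) (A : Set ℝ) : (0 : ℝ) ∈ spectrum δ A :=
  ⟨0, fun _ => 0, by simp, by simp⟩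

theorem mul_add_mem_spectrum {δ : ℝ} {A : Set ℝ} {x c : ℝ} (hx : x ∈ spectrum δ A) (hc : c ∈ A) :
    δ * x + c ∈ spectrum δ A := by
  obtain ⟨l, a, ha, rfl⟩ := hx
  refine ⟨l + 1, fun n => if n < l then a n else c, fun n _ => ?_, ?_⟩
  · by_cases h : n < l
    · simpa [h] using ha n h
    · simpa [h] using hc
  · rw [Finset.sum_range_succ, Finset.mul_sum]
    congr 1
    · refine Finset.sum_congr rfl fun n hn => ?_
      have hn := Finset.mem_range.1 hn
      simp only [if_pos hn]
      rw [show l + 1 - 1 - n = (l - 1 - n) + 1 by omega, pow_succ]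
      ring
    · simp

/-- Since `δ` is itself integral, clearing the denominators of the letters clears those of the whole
spectrum, whatever the length of the words. -/
theorem exists_common_integral_multiple {A : Set ℝ} (hA : A.Finite)
    (halg : ∀ a ∈ A, IsAlgebraic ℤ a) : ∃ d : ℤ, d ≠ 0 ∧ ∀ a ∈ A, IsIntegral ℤ ((d : ℝ) * a) := by
  induction A, hA using Set.Finite.induction_on with
  | empty => exact ⟨1, one_ne_zero, by simp⟩
  | @insert a s _ _ ih =>
    obtain ⟨d, hd, h⟩ := ih fun b hb => halg b (Set.mem_insert_of_mem _ hb)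
    obtain ⟨e, he, h'⟩ := (halg a (Set.mem_insert _ _)).exists_integral_multiple
    refine ⟨d * e, mul_ne_zero hd he, ?_⟩
    have hint : ∀ z : ℤ, IsIntegral ℤ (z : ℝ) := fun z => isIntegral_algebraMap (x := z)
    rintro b (rfl | hb)
    · have := (hint d).mul h'
      rw [zsmul_eq_mul] at this
      push_cast
      rwa [mul_assoc]
    · have := (hint e).mul (h b hb)
      push_cast
      rwa [mul_comm (d : ℝ), mul_assoc]

/-- Dominated by a geometric series of ratio `‖φ δ‖ < 1`; the point is that the bound does not
depend on the length `l`. -/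
theorem spectrum_norm_embedding_le {K : Type} [Field K] (φ : K →+* ℂ) {δ : K} {A : Set K} {B : ℝ}
    (hB : ∀ a ∈ A, ‖φ a‖ ≤ B) (hB0 : 0 ≤ B) (hδ : ‖φ δ‖ < 1) {l : ℕ} {a : ℕ → K}
    (ha : ∀ n < l, a n ∈ A) :
    ‖φ (∑ n ∈ Finset.range l, a n * δ ^ (l - 1 - n))‖ ≤ B * (1 - ‖φ δ‖)⁻¹ := by
  calc ‖φ (∑ n ∈ Finset.range l, a n * δ ^ (l - 1 - n))‖
      ≤ ∑ n ∈ Finset.range l, B * ‖φ δ‖ ^ (l - 1 - n) := by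
        rw [map_sum]
        refine norm_sum_le_of_le _ fun n hn => ?_
        rw [map_mul, map_pow, norm_mul, norm_pow]
        exact mul_le_mul_of_nonneg_right (hB _ (ha n (Finset.mem_range.1 hn))) (by positivity)
    _ = ∑ n ∈ Finset.range l, B * ‖φ δ‖ ^ n :=
        Finset.sum_range_reflect (fun n => B * ‖φ δ‖ ^ n) l
    _ ≤ B * (1 - ‖φ δ‖)⁻¹ := by
        rw [← Finset.mul_sum, ← tsum_geometric_of_lt_one (norm_nonneg _) hδ]
        exact mul_le_mul_of_nonneg_left
          ((summable_geometric_of_lt_one (norm_nonneg _) hδ).sum_le_tsum _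
            fun _ _ => by positivity) hB0

/-- The spectrum of a Pisot number over a finite alphabet in the field it generates has only
finitely many points in each bounded interval. -/
theorem finite_spectrum_inter {δ : ℝ} (hδ : IsPisot δ) {A : Set ℝ} (hA : A.Finite)
    (hmem : ∀ a ∈ A, a ∈ adjoin ℚ {δ}) (C : ℝ) : {s ∈ spectrum δ A | |s| ≤ C}.Finite := by
  obtain ⟨hint, -, hconj⟩ := hδ
  have hintQ : IsIntegral ℚ δ := hint.tower_top
  let K := adjoin ℚ {δ}
  have : FiniteDimensional ℚ K := adjoin.finiteDimensional hintQ
  have : NumberField K := ⟨⟩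
  have halg : ∀ a ∈ A, IsAlgebraic ℤ a := fun a ha => by
    have h1 : IsAlgebraic ℚ (⟨a, hmem a ha⟩ : K) := Algebra.IsAlgebraic.isAlgebraic _
    have h2 : IsAlgebraic ℚ a := h1.algebraMap (A := ℝ)
    exact (IsFractionRing.isAlgebraic_iff ℤ ℚ ℝ).2 h2
  obtain ⟨d, hd, hdA⟩ := exists_common_integral_multiple hA halg
  let g : K := ⟨δ, mem_adjoin_simple_self ℚ δ⟩
  let A' : Set K := {a | (a : ℝ) ∈ A}
  have hA' : A'.Finite := hA.preimage Subtype.val_injective.injOn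
  let S : Set K := {x | ((x : K) : ℝ) ∈ spectrum δ A ∧ |(x : ℝ)| ≤ C}
  have hS : ∀ x ∈ S, ∃ (l : ℕ) (a : ℕ → K), (∀ n < l, a n ∈ A') ∧
      x = ∑ n ∈ Finset.range l, a n * g ^ (l - 1 - n) := by
    rintro x ⟨⟨l, a, ha, hx⟩, -⟩
    classical
    refine ⟨l, fun n => if h : n < l then ⟨a n, hmem _ (ha n h)⟩ else 0, fun n hn => ?_, ?_⟩
    · simpa [hn, A'] using ha n hn
    · apply Subtype.ext
      rw [hx]
      push_cast
      refine Finset.sum_congr rfl fun n hn => ?_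
      rw [dif_pos (Finset.mem_range.1 hn)]
  have hbound : ∀ φ : K →+* ℂ, ∃ B : ℝ, ∀ x ∈ S, ‖φ x‖ ≤ B := by
    intro φ
    -- An embedding is determined by the image of `δ`: either it is the inclusion, where `C` bounds
    -- it, or it sends `δ` to another conjugate, where the Pisot condition applies.
    by_cases hφ : φ g = (δ : ℂ)
    · refine ⟨C, fun x hx => ?_⟩
      have : φ.toRatAlgHom = (Complex.ofRealHom.toRatAlgHom).comp K.val := by
        apply algHom_ext_of_eq_adjoin ℚ (rfl : K = adjoin ℚ {δ})
        rintro y rfl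
        exact hφ
      have hx' : φ x = ((x : ℝ) : ℂ) := congrArg (fun f => f x) this
      rw [hx', Complex.norm_real]
      exact hx.2
    · have hroot : Polynomial.aeval (φ g) (minpoly ℚ δ) = 0 := by
        have h1 : minpoly ℚ δ = minpoly ℚ g := by
          exact minpoly.algebraMap_eq (B := K) (B' := ℝ) Subtype.val_injective g
        rw [h1]
        have := Polynomial.aeval_algHom_apply φ.toRatAlgHom g (minpoly ℚ g)
        rw [minpoly.aeval, map_zero] at this
        exact this
      have hlt := hconj _ hroot hφ
      obtain ⟨B, hB⟩ := (hA'.image fun a => ‖φ a‖).bddAbove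
      refine ⟨|B| * (1 - ‖φ g‖)⁻¹, fun x hx => ?_⟩
      obtain ⟨l, a, ha, rfl⟩ := hS x hx
      exact spectrum_norm_embedding_le φ
        (fun b hb => (hB ⟨b, hb, rfl⟩).trans (le_abs_self B)) (abs_nonneg B) hlt ha
  choose Bf hBf using hbound
  -- A single bound must serve all embeddings, hence the sum of the `|Bf φ|`; the factor `|d|` is
  -- there because `d * x`, not `x`, is integral.
  have hfin := NumberField.Embeddings.finite_of_norm_le K ℂ (|(d : ℝ)| * ∑ φ, |Bf φ|)
  have hSfin : S.Finite := by
    refine (hfin.preimage (f := fun x : K => (d : K) * x) ?_).subset ?_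
    · intro x _ y _ hxy
      exact mul_left_cancel₀ (by exact_mod_cast hd) hxy
    · intro x hx
      refine ⟨?_, fun φ => ?_⟩
      · rw [← isIntegral_algebraMap_iff (A := K) (B := ℝ) (R := ℤ) Subtype.val_injective]
        obtain ⟨l, a, ha, hxa⟩ := hS x hx
        have : algebraMap K ℝ ((d : K) * x) =
            ∑ n ∈ Finset.range l, ((d : ℝ) * (a n : ℝ)) * δ ^ (l - 1 - n) := by
          rw [hxa, map_mul, map_sum, Finset.mul_sum]
          refine Finset.sum_congr rfl fun n _ => ?_
          rw [mul_assoc, map_mul, map_pow]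
          simp only [map_intCast]
          rfl
        rw [this]
        exact IsIntegral.sum _ fun n hn =>
          (hdA _ (ha n (Finset.mem_range.1 hn))).mul (hint.pow _)
      · rw [map_mul, norm_mul, map_intCast, Complex.norm_intCast]
        refine mul_le_mul_of_nonneg_left ?_ (abs_nonneg _)
        exact ((hBf φ x hx).trans (le_abs_self _)).trans
          (Finset.single_le_sum (f := fun φ => |Bf φ|) (fun _ _ => abs_nonneg _)
            (Finset.mem_univ φ))
  refine (hSfin.image Subtype.val).subset ?_
  rintro s ⟨hs, hsC⟩
  have hsK : s ∈ K := by
    obtain ⟨l, a, ha, rfl⟩ := hs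
    exact sum_mem fun n hn => mul_mem (hmem _ (ha n (Finset.mem_range.1 hn)))
      (pow_mem (mem_adjoin_simple_self ℚ δ) _)
  exact ⟨⟨s, hsK⟩, ⟨hs, hsC⟩, rfl⟩

/-! ### Intersection of Büchi automata -/

namespace BuchiAutomaton

variable {α σ τ : Type}

theorem IsFinite.inter {M : BuchiAutomaton α σ} {N : BuchiAutomaton α τ} (hM : M.IsFinite)
    (hN : N.IsFinite) : (M.inter N).IsFinite := by
  refine ⟨?_, hM.2.subset Set.inter_subset_left⟩
  refine (hM.1.prod (hN.1.prod (Set.finite_univ (α := Bool)))).subset ?_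
  rintro ⟨a, b, c⟩ ⟨h1, h2⟩
  exact ⟨h1, h2, Set.mem_univ _⟩

theorem language_inter (M : BuchiAutomaton α σ) (N : BuchiAutomaton α τ) :
    (M.inter N).language = M.language ∩ N.language := by
  classical
  ext w
  constructor
  · rintro ⟨q, h0, htr, hfin⟩
    refine ⟨⟨fun n => (q n).1, h0.1, fun n => (htr n).1, hfin.mono fun n h => h.1⟩,
      ⟨fun n => (q n).2.1, h0.2.1, fun n => (htr n).2.1, ?_⟩⟩
    rw [Filter.frequently_atTop] at hfin ⊢
    intro a
    by_contra! hno
    obtain ⟨b, hab, hb⟩ := hfin a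
    -- A visit to a final state of the product raises the flag. Without further final states of `N`
    -- it is never lowered, whereas final states of the product need a lowered flag.
    have htrue : ∀ k, (q (b + 1 + k)).2.2 = true := by
      intro k
      induction k with
      | zero => exact (htr b).2.2.2 (Or.inl ⟨hb.2.2, hb.1⟩)
      | succ k ih =>
        exact (htr (b + 1 + k)).2.2.2 (Or.inr ⟨ih, hno _ (by omega)⟩)
    obtain ⟨c, hbc, hc⟩ := hfin (b + 1)
    have := htrue (c - (b + 1))
    rw [show b + 1 + (c - (b + 1)) = c by omega, hc.2.2] at this
    exact absurd this (by simp)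
  · rintro ⟨⟨q, hq0, hq, hqf⟩, ⟨r, hr0, hr, hrf⟩⟩
    -- The flag is a deterministic function of the two given runs.
    let f : ℕ → Bool := fun n => Nat.rec false (fun n b =>
      decide ((b = false ∧ q n ∈ M.final) ∨ (b = true ∧ r n ∉ N.final))) n
    have hf : ∀ n, f (n + 1) = true ↔
        (f n = false ∧ q n ∈ M.final) ∨ (f n = true ∧ r n ∉ N.final) := fun n =>
      decide_eq_true_iff
    refine ⟨fun n => (q n, r n, f n), ⟨hq0, hr0, rfl⟩, fun n => ⟨hq n, hr n, hf n⟩, ?_⟩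
    rw [Filter.frequently_atTop] at hqf hrf ⊢
    intro a
    by_contra! hno
    have hno' : ∀ b, a ≤ b → f b = false → q b ∉ M.final := fun b hab hb hqb =>
      hno b hab ⟨hqb, (N.trans_mem _ _ _ (hr b)).1, hb⟩
    have hfalse : ∀ b, a ≤ b → f b = false → ∀ k, f (b + k) = false := by
      intro b hab hb k
      induction k with
      | zero => exact hb
      | succ k ih =>
        rw [← Bool.not_eq_true, ← add_assoc, hf]
        rintro (⟨h1, h2⟩ | ⟨h1, h2⟩)
        · exact hno' _ (by omega) h1 h2
        · rw [ih] at h1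
          exact absurd h1 (by simp)
    -- A final state of `N` lowers a raised flag; by `hfalse` it then stays lowered, and the next
    -- final state of `M` is accepting in the product.
    obtain ⟨b, hab, hb⟩ : ∃ b, a ≤ b ∧ f b = false := by
      by_contra! hall
      obtain ⟨b, hab, hb⟩ := hrf a
      have h1 := hall b hab
      have h2 := hall (b + 1) (by omega)
      rw [Bool.ne_false_iff] at h1 h2
      rcases (hf b).1 h2 with h | h
      · rw [h1] at h
        exact absurd h.1 (by simp)
      · exact h.2 hb
    obtain ⟨c, hbc, hc⟩ := hqf b
    refine hno' c (hab.trans hbc) ?_ hc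
    have := hfalse b hab hb (c - b)
    rwa [show b + (c - b) = c by omega] at this

end BuchiAutomaton

end AlternateBase

namespace AlternateBase

/-! ### Cantor series -/

/-- The value of `a` in the Cantor base `b`. -/
noncomputable def cantorVal (b : ℕ → ℝ) (a : ℕ → ℤ) : ℝ :=
  ∑' n, (a n : ℝ) / ∏ k ∈ Finset.range (n + 1), b k

theorem pow_le_prod_range {b : ℕ → ℝ} {c : ℝ} (hc : 1 < c) (hb : ∀ n, c ≤ b n) (n : ℕ) :
    c ^ n ≤ ∏ k ∈ Finset.range n, b k := by
  calc c ^ n = ∏ _k ∈ Finset.range n, c := by simp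
    _ ≤ _ := Finset.prod_le_prod (fun _ _ => by linarith) fun k _ => hb k

theorem prod_range_pos {b : ℕ → ℝ} {c : ℝ} (hc : 1 < c) (hb : ∀ n, c ≤ b n) (n : ℕ) :
    0 < ∏ k ∈ Finset.range n, b k :=
  Finset.prod_pos fun k _ => by linarith [hb k]

theorem summable_cantor {b : ℕ → ℝ} {c : ℝ} (hc : 1 < c) (hb : ∀ n, c ≤ b n) {a : ℕ → ℤ} {C : ℝ}
    (ha : ∀ n, |(a n : ℝ)| ≤ C) :
    Summable fun n => (a n : ℝ) / ∏ k ∈ Finset.range (n + 1), b k := by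
  have hc0 : 0 < c := by linarith
  have hg : Summable fun n : ℕ => C * (c⁻¹) ^ (n + 1) :=
    ((summable_nat_add_iff 1).2
      (summable_geometric_of_lt_one (by positivity) (inv_lt_one_of_one_lt₀ hc))).mul_left C
  refine Summable.of_norm_bounded hg fun n => ?_
  have hp := prod_range_pos hc hb (n + 1)
  rw [Real.norm_eq_abs, abs_div, abs_of_pos hp, inv_pow, ← div_eq_mul_inv]
  exact div_le_div₀ ((abs_nonneg _).trans (ha n)) (ha n) (by positivity)
    (pow_le_prod_range hc hb _)

theorem mul_cantorVal {b : ℕ → ℝ} {c : ℝ} (hc : 1 < c) (hb : ∀ n, c ≤ b n) {a : ℕ → ℤ} {C : ℝ}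
    (ha : ∀ n, |(a n : ℝ)| ≤ C) :
    b 0 * cantorVal b a =
      a 0 + cantorVal (fun k => b (k + 1)) (fun k => a (k + 1)) := by
  have hb0 : b 0 ≠ 0 := by linarith [hb 0]
  rw [cantorVal, (summable_cantor hc hb ha).tsum_eq_zero_add, mul_add, cantorVal, ← tsum_mul_left]
  congr 1
  · simp
    field_simp
  · refine tsum_congr fun n => ?_
    rw [Finset.prod_range_succ' _ (n + 1)]
    field_simp

theorem cantorVal_sub {b : ℕ → ℝ} {c : ℝ} (hc : 1 < c) (hb : ∀ n, c ≤ b n) {u v : ℕ → ℤ} {C C' : ℝ}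
    (hu : ∀ n, |(u n : ℝ)| ≤ C) (hv : ∀ n, |(v n : ℝ)| ≤ C') :
    cantorVal b (fun n => u n - v n) = cantorVal b u - cantorVal b v := by
  rw [cantorVal, cantorVal, cantorVal,
    ← (summable_cantor hc hb hu).tsum_sub (summable_cantor hc hb hv)]
  exact tsum_congr fun n => by push_cast; ring

theorem cantorVal_mono {b : ℕ → ℝ} {c : ℝ} (hc : 1 < c) (hb : ∀ n, c ≤ b n) {u v : ℕ → ℤ} {C C' : ℝ}
    (hu : ∀ n, |(u n : ℝ)| ≤ C) (hv : ∀ n, |(v n : ℝ)| ≤ C') (h : ∀ n, u n ≤ v n) :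
    cantorVal b u ≤ cantorVal b v :=
  (summable_cantor hc hb hu).tsum_le_tsum
    (fun n => div_le_div_of_nonneg_right (by exact_mod_cast h n) (prod_range_pos hc hb _).le)
    (summable_cantor hc hb hv)

theorem cantorVal_nonneg {b : ℕ → ℝ} {c : ℝ} (hc : 1 < c) (hb : ∀ n, c ≤ b n) {a : ℕ → ℤ}
    (ha : ∀ n, 0 ≤ a n) : 0 ≤ cantorVal b a :=
  tsum_nonneg fun n => div_nonneg (by exact_mod_cast ha n) (prod_range_pos hc hb _).le

/-- Bounded remainders determine the value of a sequence of digits. -/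
theorem cantorVal_eq_of_remainders {b : ℕ → ℝ} {c : ℝ} (hc : 1 < c) (hb : ∀ n, c ≤ b n)
    {a : ℕ → ℤ} {C : ℝ} (ha : ∀ n, |(a n : ℝ)| ≤ C) {s : ℕ → ℝ}
    (hs : ∀ n, s (n + 1) = b n * s n - a n) {B : ℝ} (hB : ∀ n, |s n| ≤ B) :
    cantorVal b a = s 0 := by
  have hpartial : ∀ n, ∑ k ∈ Finset.range n, (a k : ℝ) / ∏ j ∈ Finset.range (k + 1), b j =
      s 0 - s n / ∏ j ∈ Finset.range n, b j := by
    intro n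
    induction n with
    | zero => simp
    | succ n ih =>
      have h1 := (prod_range_pos hc hb n).ne'
      have h2 : b n ≠ 0 := by linarith [hb n]
      rw [Finset.sum_range_succ, ih, hs, Finset.prod_range_succ]
      field_simp
      ring
  have hlim : Filter.Tendsto (fun n => s 0 - s n / ∏ j ∈ Finset.range n, b j) Filter.atTop
      (nhds (s 0 - 0)) := by
    refine tendsto_const_nhds.sub ?_
    have hc0 : 0 < c := by linarith
    have hg : Filter.Tendsto (fun n : ℕ => B * c⁻¹ ^ n) Filter.atTop (nhds (B * 0)) :=
      (tendsto_pow_atTop_nhds_zero_of_lt_one (by positivity)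
        (inv_lt_one_of_one_lt₀ hc)).const_mul B
    rw [mul_zero] at hg
    refine squeeze_zero_norm (fun n => ?_) hg
    rw [Real.norm_eq_abs, abs_div, abs_of_pos (prod_range_pos hc hb n), inv_pow,
      ← div_eq_mul_inv]
    exact div_le_div₀ ((abs_nonneg _).trans (hB n)) (hB n) (by positivity)
      (pow_le_prod_range hc hb _)
  have h := (summable_cantor hc hb ha).hasSum.tendsto_sum_nat
  simp only [hpartial] at h
  rw [sub_zero] at hlim
  exact tendsto_nhds_unique h hlim

/-- The value of the digits of `a` from position `n` on. -/
noncomputable def tail (b : ℕ → ℝ) (a : ℕ → ℤ) (n : ℕ) : ℝ :=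
  cantorVal (fun k => b (k + n)) (fun k => a (k + n))

theorem tail_zero (b : ℕ → ℝ) (a : ℕ → ℤ) : tail b a 0 = cantorVal b a := rfl

theorem tail_succ {b : ℕ → ℝ} {c : ℝ} (hc : 1 < c) (hb : ∀ n, c ≤ b n) {a : ℕ → ℤ} {C : ℝ}
    (ha : ∀ n, |(a n : ℝ)| ≤ C) (n : ℕ) : tail b a (n + 1) = b n * tail b a n - a n := by
  have := mul_cantorVal hc (fun k => hb (k + n)) (fun k => ha (k + n))
  simp only [zero_add] at this
  rw [tail, tail, this, add_sub_cancel_left]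
  congr 1 <;> (funext k; congr 1; ring)

/-- One geometric series dominates all tails because `c` bounds the base from below at every
position. -/
theorem exists_abs_tail_le {b : ℕ → ℝ} {c : ℝ} (hc : 1 < c) (hb : ∀ n, c ≤ b n) {a : ℕ → ℤ} {C : ℝ}
    (ha : ∀ n, |(a n : ℝ)| ≤ C) : ∃ B, ∀ n, |tail b a n| ≤ B := by
  have hc0 : 0 < c := by linarith
  have hg : Summable fun n : ℕ => C * (c⁻¹) ^ (n + 1) :=
    ((summable_nat_add_iff 1).2
      (summable_geometric_of_lt_one (by positivity) (inv_lt_one_of_one_lt₀ hc))).mul_left C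
  refine ⟨∑' n : ℕ, C * (c⁻¹) ^ (n + 1), fun n => ?_⟩
  rw [← Real.norm_eq_abs, tail, cantorVal]
  refine tsum_of_norm_bounded hg.hasSum fun k => ?_
  have hp := prod_range_pos hc (fun k => hb (k + n)) (k + 1)
  rw [Real.norm_eq_abs, abs_div, abs_of_pos hp, inv_pow, ← div_eq_mul_inv]
  exact div_le_div₀ ((abs_nonneg _).trans (ha (k + n))) (ha (k + n)) (by positivity)
    (pow_le_prod_range hc (fun k => hb (k + n)) _)

/-- The Horner scheme: `horner b e n = ∑_{l < n} e_l b_{l+1} ⋯ b_{n-1}`. -/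
noncomputable def horner (b : ℕ → ℝ) (e : ℕ → ℤ) : ℕ → ℝ
  | 0 => 0
  | n + 1 => b n * horner b e n + e n

/-- Both sides obey the same recurrence and vanish at 0. A Horner sum, read off from the past
digits, is thereby controlled by the future ones. -/
theorem horner_eq_neg_tail {b : ℕ → ℝ} {c : ℝ} (hc : 1 < c) (hb : ∀ n, c ≤ b n) {e : ℕ → ℤ} {C : ℝ}
    (he : ∀ n, |(e n : ℝ)| ≤ C) (h0 : cantorVal b e = 0) (n : ℕ) :
    horner b e n = -tail b e n := by
  induction n with
  | zero => simp [horner, tail_zero, h0]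
  | succ n ih => rw [horner, ih, tail_succ hc hb he]; ring

/-- A sequence that is positive at `N` and grows by a factor `≥ c > 1` at each later step is
unbounded. -/
theorem not_bounded_of_expanding {c : ℝ} (hc : 1 < c) {g : ℕ → ℝ} {N : ℕ} (hN : 0 < g N)
    (hg : ∀ n, N ≤ n → 0 < g n → c * g n ≤ g (n + 1)) (B : ℝ) : ∃ n, N ≤ n ∧ B < g n := by
  have hpow : ∀ k, 0 < g (N + k) ∧ c ^ k * g N ≤ g (N + k) := by
    intro k
    induction k with
    | zero => simpa using hN
    | succ k ih =>
      have h := hg (N + k) (by omega) ih.1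
      have hcpos : 0 < c := by linarith
      have h1 := mul_le_mul_of_nonneg_left ih.2 hcpos.le
      refine ⟨lt_of_lt_of_le (mul_pos hcpos ih.1) h, ?_⟩
      rw [pow_succ]
      calc c ^ k * c * g N = c * (c ^ k * g N) := by ring
        _ ≤ _ := h1.trans h
  obtain ⟨k, hk⟩ := pow_unbounded_of_one_lt (B / g N) hc
  rw [div_lt_iff₀ hN] at hk
  exact ⟨N + k, by omega, hk.trans_le (hpow k).2⟩

/-! ### Quasi-greedy expansions of one -/

/-- Remainders of the quasi-greedy algorithm started at `1`; they lie in `(0, 1]`. -/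
noncomputable def qrem (b : ℕ → ℝ) : ℕ → ℝ
  | 0 => 1
  | n + 1 => b n * qrem b n - (⌈b n * qrem b n⌉ - 1)

/-- Digits of the quasi-greedy algorithm started at `1`. -/
noncomputable def qdig (b : ℕ → ℝ) (n : ℕ) : ℤ := ⌈b n * qrem b n⌉ - 1

theorem qrem_succ (b : ℕ → ℝ) (n : ℕ) : qrem b (n + 1) = b n * qrem b n - qdig b n := by
  simp [qrem, qdig]

theorem qrem_pos (b : ℕ → ℝ) (n : ℕ) : 0 < qrem b n := by
  cases n with
  | zero => simp [qrem]
  | succ n => rw [qrem]; linarith [Int.ceil_lt_add_one (b n * qrem b n)]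

theorem qrem_le_one (b : ℕ → ℝ) (n : ℕ) : qrem b n ≤ 1 := by
  cases n with
  | zero => simp [qrem]
  | succ n => rw [qrem]; linarith [Int.le_ceil (b n * qrem b n)]

theorem qdig_nonneg {b : ℕ → ℝ} (hb : ∀ n, 0 < b n) (n : ℕ) : 0 ≤ qdig b n := by
  have : 0 < ⌈b n * qrem b n⌉ := Int.ceil_pos.2 (mul_pos (hb n) (qrem_pos b n))
  rw [qdig]
  omega

theorem qdig_le {b : ℕ → ℝ} (hb : ∀ n, 0 < b n) (n : ℕ) : qdig b n ≤ ⌈b n⌉ - 1 :=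
  sub_le_sub_right (Int.ceil_mono (mul_le_of_le_one_right (hb n).le (qrem_le_one b n))) _

/-- Once a remainder recurs at a place where the base looks the same from there on, the whole future
recurs; this is how periodicity arises. -/
theorem qrem_add_of_eq {b : ℕ → ℝ} {N N' : ℕ} (h : qrem b N = qrem b N')
    (hb : ∀ k, b (N + k) = b (N' + k)) (k : ℕ) : qrem b (N + k) = qrem b (N' + k) := by
  induction k with
  | zero => exact h
  | succ k ih => rw [← add_assoc, ← add_assoc, qrem, qrem, ih, hb]

theorem qdig_add_of_eq {b : ℕ → ℝ} {N N' : ℕ} (h : qrem b N = qrem b N')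
    (hb : ∀ k, b (N + k) = b (N' + k)) (k : ℕ) : qdig b (N + k) = qdig b (N' + k) := by
  rw [qdig, qdig, qrem_add_of_eq h hb, hb]

/-- Just below `y` the floor function is constant, equal to `⌈y⌉ - 1`. -/
theorem eventually_floor_eq (y : ℝ) : ∀ᶠ z in nhdsWithin y (Set.Iio y), ⌊z⌋ = ⌈y⌉ - 1 := by
  have h : Set.Ioo (((⌈y⌉ - 1 : ℤ)) : ℝ) y ∈ nhdsWithin y (Set.Iio y) :=
    Ioo_mem_nhdsLT (by push_cast; linarith [Int.ceil_lt_add_one y])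
  filter_upwards [h] with z hz
  rw [Int.floor_eq_iff]
  refine ⟨hz.1.le, hz.2.trans_le ?_⟩
  push_cast
  linarith [Int.le_ceil y]

end AlternateBase

namespace AlternateBase

variable {p : ℕ} [NeZero p]

/-! ### Periodic extensions -/

theorem ofNat_add_ofNat (m n : ℕ) : Fin.ofNat p m + Fin.ofNat p n = Fin.ofNat p (m + n) := by
  apply Fin.ext
  simp [Fin.val_add]

theorem ofNat_succ (n : ℕ) : Fin.ofNat p n + 1 = Fin.ofNat p (n + 1) := by
  rw [← ofNat_add_ofNat]
  congr 1

theorem cyc_shift {X : Type} (x : Fin p → X) (m n : ℕ) :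
    cyc (shift x (Fin.ofNat p m)) n = cyc x (n + m) := by
  rw [cyc, shift, ofNat_add_ofNat, cyc]

theorem cyc_add_mul {X : Type} (x : Fin p → X) (l n : ℕ) : cyc x (p * l + n) = cyc x n := by
  rw [cyc, cyc]
  congr 1
  apply Fin.ext
  simp

theorem cyc_val {X : Type} (x : Fin p → X) (i : Fin p) : cyc x i = x i := by
  rw [cyc]
  congr 1
  apply Fin.ext
  simp

theorem prod_shift (β : Fin p → ℝ) (i : Fin p) : ∏ k, shift β i k = ∏ k, β k :=
  Fintype.prod_equiv (Equiv.addRight i) _ _ fun _ => rfl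

theorem val_eq_cantorVal (β : Fin p → ℝ) (a : ℕ → ℤ) : val β a = cantorVal (cyc β) a := rfl

theorem val_shift_eq_tail (β : Fin p → ℝ) (a : ℕ → ℤ) (n : ℕ) :
    val (shift β (Fin.ofNat p n)) (fun k => a (k + n)) = tail (cyc β) a n := by
  rw [val_eq_cantorVal, tail]
  congr 1
  funext k
  exact cyc_shift β n k

theorem exists_lower_bound {β : Fin p → ℝ} (hβ : ∀ i, 1 < β i) : ∃ c, 1 < c ∧ ∀ n, c ≤ cyc β n := by
  obtain ⟨i, hi⟩ := Finite.exists_min β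
  exact ⟨β i, hβ i, fun n => hi _⟩

omit [NeZero p] in
theorem exists_digit_bound (D : Fin p → Finset ℤ) :
    ∃ C : ℝ, ∀ i, ∀ a ∈ D i, |(a : ℝ)| ≤ C := by
  obtain ⟨C, hC⟩ := ((Finset.univ.biUnion D).finite_toSet.image fun a : ℤ => |(a : ℝ)|).bddAbove
  exact ⟨C, fun i a ha => hC ⟨a, by simpa using ⟨i, ha⟩, rfl⟩⟩

theorem exists_abs_le_of_mem_cyc (D : Fin p → Finset ℤ) :
    ∃ C : ℝ, ∀ a : ℕ → ℤ, (∀ n, a n ∈ cyc D n) → ∀ n, |(a n : ℝ)| ≤ C := by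
  obtain ⟨C, hC⟩ := exists_digit_bound D
  exact ⟨C, fun a ha n => hC _ _ (ha n)⟩

theorem mem_cyc_greedyAlphabet {β : Fin p → ℝ} {n : ℕ} {a : ℤ} :
    a ∈ cyc (greedyAlphabet β) n ↔ 0 ≤ a ∧ a ≤ ⌈cyc β n⌉ - 1 := by
  rw [cyc, greedyAlphabet, Finset.mem_Icc, cyc]

/-! ### Greedy expansions -/

theorem rem_succ (β : Fin p → ℝ) (x : ℝ) (n : ℕ) :
    rem β x (n + 1) = cyc β n * rem β x n - greedy β x n := rfl

theorem rem_mem_Ico (β : Fin p → ℝ) {x : ℝ} (hx : x ∈ Set.Ico (0 : ℝ) 1) (n : ℕ) :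
    rem β x n ∈ Set.Ico (0 : ℝ) 1 := by
  cases n with
  | zero => exact hx
  | succ n => exact ⟨Int.fract_nonneg _, Int.fract_lt_one _⟩

theorem greedy_mem {β : Fin p → ℝ} (hβ : ∀ i, 1 < β i) {x : ℝ} (hx : x ∈ Set.Ico (0 : ℝ) 1)
    (n : ℕ) : greedy β x n ∈ cyc (greedyAlphabet β) n := by
  have hb : 1 < cyc β n := hβ _
  have hr := rem_mem_Ico β hx n
  rw [mem_cyc_greedyAlphabet]
  refine ⟨Int.floor_nonneg.2 (mul_nonneg (by linarith) hr.1), ?_⟩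
  have : greedy β x n < ⌈cyc β n⌉ := by
    rw [greedy, Int.floor_lt]
    exact (mul_lt_of_lt_one_right (by linarith) hr.2).trans_le (Int.le_ceil _)
  omega

theorem val_greedy {β : Fin p → ℝ} (hβ : ∀ i, 1 < β i) {x : ℝ} (hx : x ∈ Set.Ico (0 : ℝ) 1) :
    val β (greedy β x) = x := by
  obtain ⟨c, hc, hb⟩ := exists_lower_bound hβ
  obtain ⟨C, hC⟩ := exists_abs_le_of_mem_cyc (greedyAlphabet β)
  refine cantorVal_eq_of_remainders hc hb (hC _ (greedy_mem hβ hx)) (rem_succ β x) (B := 1)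
    fun n => ?_
  have := rem_mem_Ico β hx n
  rw [abs_of_nonneg this.1]
  exact this.2.le

/-- A sequence of digits all of whose tails have values in `[0, 1)` is a greedy expansion. -/
theorem eq_greedy_of_tail_mem {β : Fin p → ℝ} (hβ : ∀ i, 1 < β i) {a : ℕ → ℤ} {C : ℝ}
    (ha : ∀ n, |(a n : ℝ)| ≤ C) (h : ∀ n, tail (cyc β) a n ∈ Set.Ico (0 : ℝ) 1) :
    a = greedy β (val β a) := by
  obtain ⟨c, hc, hb⟩ := exists_lower_bound hβ
  have hfloor : ∀ n, ⌊cyc β n * tail (cyc β) a n⌋ = a n := fun n => by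
    have h1 := h (n + 1)
    rw [tail_succ hc hb ha] at h1
    rw [Int.floor_eq_iff]
    exact ⟨by linarith [h1.1], by linarith [h1.2]⟩
  have hrem : ∀ n, rem β (val β a) n = tail (cyc β) a n := by
    intro n
    induction n with
    | zero => rfl
    | succ n ih => rw [rem, ih, hfloor, tail_succ hc hb ha]
  funext n
  rw [greedy, hrem, hfloor]

/-- By `val_greedy` a greedy expansion determines its `x`, so equality of values identifies `x` with
the value of the first word. -/
theorem normalizationPairs_eq_graph {β : Fin p → ℝ} (hβ : ∀ i, 1 < β i) (D : Fin p → Finset ℤ) :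
    normalizationPairs β D =
      {w | (fun n => (w n).2) ∈ normalization β D (fun n => (w n).1)} := by
  ext w
  constructor
  · rintro ⟨hw, hval, x, hx, hv⟩
    rw [hv, val_greedy hβ hx] at hval
    refine ⟨⟨fun n => (hw n).1, ?_⟩, ?_⟩
    · rwa [hval]
    · change greedy β (val β _) = _
      rw [hval, hv]
  · rintro ⟨⟨hD, hx⟩, hv⟩
    replace hv : greedy β (val β fun n => (w n).1) = fun n => (w n).2 := hv
    refine ⟨fun n => ⟨hD n, ?_⟩, ?_, _, hx, hv.symm⟩
    · rw [← congrFun hv n]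
      exact greedy_mem hβ hx n
    · rw [← hv, val_greedy hβ hx]

/-! ### The quasi-greedy expansion as a limit -/

/-- The induction carries convergence strictly from the left: just below a point the floor is
constant, which fixes the digit and makes the next remainder again converge from the left. -/
theorem tendsto_rem {β : Fin p → ℝ} (hβ : ∀ i, 1 < β i) (n : ℕ) :
    Filter.Tendsto (fun x => rem β x n) (nhdsWithin 1 (Set.Iio 1))
      (nhdsWithin (qrem (cyc β) n) (Set.Iio (qrem (cyc β) n))) ∧
    ∀ᶠ x in nhdsWithin 1 (Set.Iio 1), greedy β x n = qdig (cyc β) n := by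
  have hmul : ∀ n, Filter.Tendsto (fun x => rem β x n) (nhdsWithin 1 (Set.Iio 1))
      (nhdsWithin (qrem (cyc β) n) (Set.Iio (qrem (cyc β) n))) →
      Filter.Tendsto (fun x => cyc β n * rem β x n) (nhdsWithin 1 (Set.Iio 1))
      (nhdsWithin (cyc β n * qrem (cyc β) n) (Set.Iio (cyc β n * qrem (cyc β) n))) := by
    intro n h
    rw [tendsto_nhdsWithin_iff] at h ⊢
    exact ⟨h.1.const_mul _, h.2.mono fun x hx =>
      mul_lt_mul_of_pos_left hx (zero_lt_one.trans (hβ _))⟩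
  have hdig : ∀ n, Filter.Tendsto (fun x => rem β x n) (nhdsWithin 1 (Set.Iio 1))
      (nhdsWithin (qrem (cyc β) n) (Set.Iio (qrem (cyc β) n))) →
      ∀ᶠ x in nhdsWithin 1 (Set.Iio 1), greedy β x n = qdig (cyc β) n := fun n h =>
    (hmul n h).eventually (eventually_floor_eq _)
  suffices h : Filter.Tendsto (fun x => rem β x n) (nhdsWithin 1 (Set.Iio 1))
      (nhdsWithin (qrem (cyc β) n) (Set.Iio (qrem (cyc β) n))) from ⟨h, hdig n h⟩
  induction n with
  | zero => exact Filter.tendsto_id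
  | succ n ih =>
    have h1 : Filter.Tendsto (fun x => cyc β n * rem β x n - qdig (cyc β) n)
        (nhdsWithin 1 (Set.Iio 1))
        (nhdsWithin (qrem (cyc β) (n + 1)) (Set.Iio (qrem (cyc β) (n + 1)))) := by
      have h2 := hmul n ih
      rw [tendsto_nhdsWithin_iff] at h2 ⊢
      rw [qrem_succ]
      exact ⟨h2.1.sub_const _, h2.2.mono fun x hx => sub_lt_sub_right (Set.mem_Iio.1 hx) _⟩
    refine h1.congr' ?_
    filter_upwards [hdig n ih] with x hx
    rw [rem_succ, hx]

theorem isQuasiGreedy_qdig {β : Fin p → ℝ} (hβ : ∀ i, 1 < β i) :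
    IsQuasiGreedy β (qdig (cyc β)) := by
  rw [IsQuasiGreedy, tendsto_pi_nhds]
  intro n
  rw [nhds_discrete, Filter.tendsto_pure]
  exact (tendsto_rem hβ n).2

/-! ### Blocks of digits -/

theorem affine_recurrence {b s a : ℕ → ℝ} (hs : ∀ n, s (n + 1) = b n * s n + a n) (N k : ℕ) :
    s (N + k) = (∏ j ∈ Finset.range k, b (N + j)) * s N +
      ∑ h ∈ Finset.range k, a (N + h) * ∏ j ∈ Finset.Ioo h k, b (N + j) := by
  induction k with
  | zero => simp
  | succ k ih =>
    have hIoo : ∀ h ∈ Finset.range k, a (N + h) * ∏ j ∈ Finset.Ioo h (k + 1), b (N + j) =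
        b (N + k) * (a (N + h) * ∏ j ∈ Finset.Ioo h k, b (N + j)) := fun h hh => by
      have hh := Finset.mem_range.1 hh
      rw [show Finset.Ioo h (k + 1) = insert k (Finset.Ioo h k) by ext; simp; omega,
        Finset.prod_insert (by simp)]
      ring
    rw [← add_assoc, hs, ih, Finset.prod_range_succ, Finset.sum_range_succ,
      Finset.sum_congr rfl hIoo, ← Finset.mul_sum]
    have : Finset.Ioo k (k + 1) = ∅ := by ext; simp
    rw [this, Finset.prod_empty]
    ring

/-- Unrolling one full period multiplies by `δ` and adds one block digit, which reduces the
alternate base to the single base `δ`. -/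
theorem block_recurrence (β : Fin p → ℝ) (D : Fin p → Finset ℤ) {s : ℕ → ℝ} {a : ℕ → ℤ}
    (ha : ∀ n, a n ∈ cyc D n) (hs : ∀ n, s (n + 1) = cyc β n * s n + a n) (l : ℕ) :
    ∃ c ∈ blockDigits β D, s (p * (l + 1)) = (∏ k, β k) * s (p * l) + c := by
  refine ⟨∑ i : Fin p, (a (p * l + i) : ℝ) * ∏ k ∈ Finset.Ioi i, β k,
    ⟨fun i => a (p * l + i), fun i => ?_, rfl⟩, ?_⟩
  · have := ha (p * l + i)
    rwa [cyc_add_mul, cyc_val] at this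
  · have h := affine_recurrence (b := cyc β) (a := fun n => (a n : ℝ)) hs (p * l) p
    rw [mul_add, mul_one, h]
    simp only [cyc_add_mul]
    rw [Finset.prod_range, Finset.sum_range]
    simp only [cyc_val]
    congr 1
    refine Finset.sum_congr rfl fun i _ => ?_
    rw [← Fin.map_valEmbedding_Ioi, Finset.prod_map]
    simp only [Fin.valEmbedding_apply, cyc_val]

omit [NeZero p] in
theorem finite_blockDigits (β : Fin p → ℝ) (D : Fin p → Finset ℤ) : (blockDigits β D).Finite := by
  have hfin : {a : Fin p → ℤ | ∀ i, a i ∈ D i}.Finite := by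
    refine (Set.Finite.pi' fun i => (D i).finite_toSet).subset fun a ha i => ha i
  refine (hfin.image fun a => ∑ i, (a i : ℝ) * ∏ k ∈ Finset.Ioi i, β k).subset ?_
  rintro x ⟨a, ha, rfl⟩
  exact ⟨a, ha, rfl⟩

omit [NeZero p] in
theorem blockDigits_subset {β : Fin p → ℝ} {K : IntermediateField ℚ ℝ} (hβ : ∀ i, β i ∈ K)
    (D : Fin p → Finset ℤ) : ∀ x ∈ blockDigits β D, x ∈ K := by
  rintro x ⟨a, -, rfl⟩
  exact sum_mem fun i _ => mul_mem (intCast_mem K _) (prod_mem fun k _ => hβ k)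

/-- The alphabet `A` and the starting point are left free so that this covers both the Horner sums,
which start at 0, and the quasi-greedy remainders, which start at 1. -/
theorem mem_spectrum_of_recurrence (β : Fin p → ℝ) (D : Fin p → Finset ℤ) {A : Set ℝ}
    (hA : blockDigits β D ⊆ A) {s : ℕ → ℝ} {a : ℕ → ℤ} (ha : ∀ n, a n ∈ cyc D n)
    (hs : ∀ n, s (n + 1) = cyc β n * s n + a n) (h0 : s 0 ∈ spectrum (∏ k, β k) A) (l : ℕ) :
    s (p * l) ∈ spectrum (∏ k, β k) A := by
  induction l with
  | zero => simpa using h0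
  | succ l ih =>
    obtain ⟨c, hc, h⟩ := block_recurrence β D ha hs l
    rw [h]
    exact mul_add_mem_spectrum ih (hA hc)

theorem exists_hasPeriod_qdig {β : Fin p → ℝ} (hβ : ∀ i, 1 < β i) (hPisot : IsPisot (∏ i, β i))
    (hmem : ∀ i, β i ∈ IntermediateField.adjoin ℚ {∏ k, β k}) :
    ∃ m n, HasPeriod (qdig (cyc β)) m n := by
  have hp : 0 < p := Nat.pos_of_neZero p
  -- The remainder recurrence subtracts digits, so the alphabets are negated. The extra letter 1 in
  -- `A` puts the initial remainder 1 into the spectrum.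
  let D : Fin p → Finset ℤ := fun i => (greedyAlphabet β i).image fun a => -a
  let A : Set ℝ := insert 1 (blockDigits β D)
  have hA : A.Finite := (finite_blockDigits β D).insert 1
  have hAmem : ∀ a ∈ A, a ∈ IntermediateField.adjoin ℚ {∏ k, β k} := by
    rintro a (rfl | ha)
    · exact one_mem _
    · exact blockDigits_subset hmem D a ha
  have hdig : ∀ n, -qdig (cyc β) n ∈ cyc D n := fun n =>
    Finset.mem_image_of_mem _ (mem_cyc_greedyAlphabet.2
      ⟨qdig_nonneg (fun _ => zero_lt_one.trans (hβ _)) n,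
        qdig_le (fun _ => zero_lt_one.trans (hβ _)) n⟩)
  have h1 : qrem (cyc β) 0 ∈ spectrum (∏ k, β k) A := by
    simpa [qrem] using
      mul_add_mem_spectrum (zero_mem_spectrum (∏ k, β k) A) (Set.mem_insert (1 : ℝ) _)
  have hspec := mem_spectrum_of_recurrence β D (A := A) (Set.subset_insert _ _) (s := qrem (cyc β))
    (a := fun n => -qdig (cyc β) n) hdig (fun n => by rw [qrem_succ]; push_cast; ring)
    h1
  have hfin := finite_spectrum_inter hPisot hA hAmem 1
  have hmaps : ∀ l : ℕ, qrem (cyc β) (p * l) ∈ {s ∈ spectrum (∏ k, β k) A | |s| ≤ 1} := fun l =>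
    ⟨hspec l, by rw [abs_of_pos (qrem_pos _ _)]; exact qrem_le_one _ _⟩
  -- Pigeonhole at multiples of `p`, where the base is in the same phase.
  obtain ⟨l, l', hne, heq⟩ : ∃ l l' : ℕ, l < l' ∧ qrem (cyc β) (p * l) = qrem (cyc β) (p * l') := by
    obtain ⟨l, -, l', -, hne, heq⟩ := Set.infinite_univ.exists_ne_map_eq_of_mapsTo
      (f := fun l : ℕ => qrem (cyc β) (p * l)) (fun l _ => hmaps l) hfin
    rcases hne.lt_or_gt with h | h
    · exact ⟨l, l', h, heq⟩
    · exact ⟨l', l, h, heq.symm⟩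
  -- The `+ 1` only serves to make the preperiod non-empty when `l = 0`.
  refine ⟨p * l + 1, p * (l' - l), by omega, Nat.mul_pos hp (by omega), fun k hk => ?_⟩
  have := qdig_add_of_eq heq (fun k => by rw [cyc_add_mul, cyc_add_mul]) (k - p * l)
  have hle : p * l ≤ p * l' := Nat.mul_le_mul_left p hne.le
  rw [show p * l + (k - p * l) = k by omega, show p * l' + (k - p * l) = k + p * (l' - l) by
    rw [Nat.mul_sub]; omega] at this
  exact this.symm

omit [NeZero p] in
theorem finite_altSpectrum_inter {β : Fin p → ℝ} (hPisot : IsPisot (∏ i, β i))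
    (hmem : ∀ i, β i ∈ IntermediateField.adjoin ℚ {∏ k, β k}) (D : Fin p → Finset ℤ) (i : Fin p)
    (C : ℝ) : {s ∈ altSpectrum β D i | |s| ≤ C}.Finite :=
  finite_spectrum_inter hPisot (finite_blockDigits _ _)
    (blockDigits_subset (β := shift β i) (fun j => hmem (j + i)) _) C

/-- The spectrum is built from complete blocks, while `n` need not be a multiple of `p`. Padding on
the left with `p * n - n` zeros completes the blocks, leaves the Horner sum unchanged and aligns the
base shifted by `n` with the original one. This is why 0 has to be a digit. -/
theorem horner_mem_altSpectrum (β : Fin p → ℝ) {E : Fin p → Finset ℤ} (h0 : ∀ i, 0 ∈ E i)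
    {e : ℕ → ℤ} (he : ∀ n, e n ∈ cyc E n) (n : ℕ) :
    horner (cyc β) e n ∈ altSpectrum β E (Fin.ofNat p n) := by
  have hp : 0 < p := Nat.pos_of_neZero p
  obtain ⟨q, hq⟩ : ∃ q, q + n = p * n := ⟨p * n - n, Nat.sub_add_cancel (Nat.le_mul_of_pos_left n hp)⟩
  let e' : ℕ → ℤ := fun k => if k < q then 0 else e (k - q)
  let s := horner (cyc (shift β (Fin.ofNat p n))) e'
  have hbase : ∀ {X : Type} (x : Fin p → X) k, cyc (shift x (Fin.ofNat p n)) (q + k) = cyc x k :=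
    fun x k => by rw [cyc_shift, show q + k + n = p * n + k by omega, cyc_add_mul]
  have he' : ∀ k, e' k ∈ cyc (shift E (Fin.ofNat p n)) k := fun k => by
    by_cases hk : k < q
    · simp only [e', if_pos hk]
      exact h0 _
    · simp only [e', if_neg hk]
      have h := he (k - q)
      rwa [← hbase E, show q + (k - q) = k by omega] at h
  have hs0 : ∀ k ≤ q, s k = 0 := by
    intro k hk
    induction k with
    | zero => rfl
    | succ k ih =>
      change _ * s k + (e' k : ℝ) = 0
      rw [ih (by omega)]
      simp [e', show k < q by omega]
  have hs : ∀ k, s (q + k) = horner (cyc β) e k := by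
    intro k
    induction k with
    | zero => exact hs0 q le_rfl
    | succ k ih =>
      change cyc (shift β (Fin.ofNat p n)) (q + k) * s (q + k) + (e' (q + k) : ℝ) = cyc β k * horner (cyc β) e k + e k
      rw [ih, hbase]
      simp [e']
  have := mem_spectrum_of_recurrence (shift β (Fin.ofNat p n)) (shift E (Fin.ofNat p n))
    subset_rfl (s := s) he' (fun k => rfl) (zero_mem_spectrum _ _) n
  rwa [← hq, hs, prod_shift] at this

/-! ### The converter -/

theorem le_maxDigit {A : Finset ℤ} {a : ℤ} (ha : a ∈ A) : a ≤ maxDigit A := by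
  have h := Finset.le_max ha
  rw [maxDigit]
  cases hA : A.max with
  | bot => rw [hA] at h; simp at h
  | coe m => rw [hA] at h; simpa using h

theorem minDigit_le {A : Finset ℤ} {a : ℤ} (ha : a ∈ A) : minDigit A ≤ a := by
  have h := Finset.min_le ha
  rw [minDigit]
  cases hA : A.min with
  | top => rw [hA] at h; simp at h
  | coe m => rw [hA] at h; simpa using h

theorem tail_mem_Icc {β : Fin p → ℝ} (hβ : ∀ i, 1 < β i) {E : Fin p → Finset ℤ} {e : ℕ → ℤ}
    (he : ∀ n, e n ∈ cyc E n) (n : ℕ) :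
    tail (cyc β) e n ∈
      Set.Icc (lower β E (Fin.ofNat p n)) (upper β E (Fin.ofNat p n)) := by
  obtain ⟨c, hc, hb⟩ := exists_lower_bound (β := shift β (Fin.ofNat p n)) fun i => hβ _
  obtain ⟨C, hC⟩ := exists_abs_le_of_mem_cyc E
  -- The two-element alphabets of extreme digits bound both extreme sequences, including the default
  -- 0 of an empty alphabet.
  obtain ⟨C', hC'⟩ := exists_abs_le_of_mem_cyc fun i => {maxDigit (E i), minDigit (E i)}
  have hmax : ∀ k, |((maxDigit (cyc (shift E (Fin.ofNat p n)) k) : ℤ) : ℝ)| ≤ C' := fun k => by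
    have := hC' (fun k => maxDigit (cyc E k)) (fun k => by simp [cyc]) (k + n)
    rwa [cyc_shift]
  have hmin : ∀ k, |((minDigit (cyc (shift E (Fin.ofNat p n)) k) : ℤ) : ℝ)| ≤ C' := fun k => by
    have := hC' (fun k => minDigit (cyc E k)) (fun k => by simp [cyc]) (k + n)
    rwa [cyc_shift]
  rw [← val_shift_eq_tail]
  constructor
  · refine cantorVal_mono hc hb hmin (fun k => hC e he (k + n)) fun k => ?_
    rw [cyc_shift]
    exact minDigit_le (he (k + n))
  · refine cantorVal_mono hc hb (fun k => hC e he (k + n)) hmax fun k => ?_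
    rw [cyc_shift]
    exact le_maxDigit (he (k + n))

/-- Along a path labelled by `w`, the converter performs the Horner scheme on the differences. -/
theorem converter_language {β : Fin p → ℝ} (hβ : ∀ i, 1 < β i) {D D' : Fin p → Finset ℤ}
    (hD : ∀ i, 0 ∈ D i) (hD' : ∀ i, 0 ∈ D' i) :
    (converter β D D').language =
      {w | w ∈ pairWords D D' ∧ val β (fun n => (w n).1) = val β (fun n => (w n).2)} := by
  obtain ⟨c, hc, hb⟩ := exists_lower_bound hβ
  obtain ⟨C, hC⟩ := exists_abs_le_of_mem_cyc D
  obtain ⟨C', hC'⟩ := exists_abs_le_of_mem_cyc D'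
  obtain ⟨CE, hCE⟩ := exists_abs_le_of_mem_cyc (diffAlphabet D D')
  have hval : ∀ w ∈ pairWords D D', cantorVal (cyc β) (fun n => (w n).1 - (w n).2) =
      val β (fun n => (w n).1) - val β (fun n => (w n).2) := fun w hw =>
    cantorVal_sub hc hb (hC _ fun n => (hw n).1) (hC' _ fun n => (hw n).2)
  have hdiff : ∀ w ∈ pairWords D D', ∀ n, (w n).1 - (w n).2 ∈ cyc (diffAlphabet D D') n :=
    fun w hw n => Finset.mem_image₂_of_mem (hw n).1 (hw n).2
  have hE : ∀ i, 0 ∈ diffAlphabet D D' i := fun i =>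
    Finset.mem_image₂.2 ⟨0, hD i, 0, hD' i, by simp⟩
  ext w
  constructor
  · rintro ⟨q, h0, htr, -⟩
    have hpos : ∀ n, (q n).1 = Fin.ofNat p n := by
      intro n
      induction n with
      | zero => rw [h0.1]; rfl
      | succ n ih => rw [(htr n).2.2.2.2.2.1, ih, ofNat_succ]
    have hw : w ∈ pairWords D D' := fun n => by
      have h := htr n
      have h1 := h.1
      have h2 := h.2.1
      simp only [hpos] at h1 h2
      exact ⟨h1, h2⟩
    refine ⟨hw, ?_⟩
    rw [← sub_eq_zero, ← hval w hw]
    -- The negated states are remainders for the differences. They are bounded because only `p`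
    -- intervals occur, so the value of the differences equals the initial remainder 0.
    have hrec : ∀ n, -(q (n + 1)).2 = cyc β n * -(q n).2 - ((w n).1 - (w n).2 : ℤ) := fun n => by
      have h := (htr n).2.2.2.2.2.2
      simp only [hpos] at h
      rw [h, cyc]
      ring
    obtain ⟨B, hB⟩ : ∃ B : ℝ, ∀ i : Fin p, |upper β (diffAlphabet D D') i| ≤ B ∧
        |lower β (diffAlphabet D D') i| ≤ B := by
      obtain ⟨B, hB⟩ := (Set.finite_range fun i : Fin p =>
        max |upper β (diffAlphabet D D') i| |lower β (diffAlphabet D D') i|).bddAbove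
      exact ⟨B, fun i => max_le_iff.1 (hB ⟨i, rfl⟩)⟩
    have hbdd : ∀ n, |-(q n).2| ≤ B := fun n => by
      have h := (htr n).2.2.1.2
      obtain ⟨h1, h2⟩ := hB (q n).1
      rw [abs_neg, abs_le]
      exact ⟨by linarith [h.1, le_abs_self (upper β (diffAlphabet D D') (q n).1)],
        by linarith [h.2, neg_abs_le (lower β (diffAlphabet D D') (q n).1)]⟩
    rw [cantorVal_eq_of_remainders hc hb (hCE _ (hdiff w hw)) (s := fun n => -(q n).2) hrec hbdd,
      h0.1]
    simp
  · rintro ⟨hw, heq⟩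
    let e : ℕ → ℤ := fun n => (w n).1 - (w n).2
    have he : ∀ n, e n ∈ cyc (diffAlphabet D D') n := hdiff w hw
    have he0 : cantorVal (cyc β) e = 0 := by rw [hval w hw, heq, sub_self]
    have hstate : ∀ n, horner (cyc β) e n ∈ altSpectrum β (diffAlphabet D D') (Fin.ofNat p n) ∩
        Set.Icc (-upper β (diffAlphabet D D') (Fin.ofNat p n))
          (-lower β (diffAlphabet D D') (Fin.ofNat p n)) := fun n => by
      refine ⟨horner_mem_altSpectrum β hE he n, ?_⟩
      have h := tail_mem_Icc hβ he n
      rw [horner_eq_neg_tail hc hb (hCE _ he) he0]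
      exact ⟨neg_le_neg h.2, neg_le_neg h.1⟩
    refine ⟨fun n => (Fin.ofNat p n, horner (cyc β) e n), ⟨rfl, hstate 0⟩, fun n => ?_,
      (Filter.Eventually.of_forall hstate).frequently⟩
    exact ⟨(hw n).1, (hw n).2, hstate n, hstate (n + 1), he n, (ofNat_succ n).symm, rfl⟩

omit [NeZero p] in
theorem finite_alphabet (D : Fin p → Finset ℤ) : {a | ∃ i, a ∈ D i}.Finite := by
  have := Set.finite_iUnion fun i => (D i).finite_toSet
  refine this.subset ?_
  rintro a ⟨i, h⟩
  exact Set.mem_iUnion.2 ⟨i, h⟩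

omit [NeZero p] in
theorem finite_pair_alphabet (D D' : Fin p → Finset ℤ) :
    {c : ℤ × ℤ | ∃ i, c.1 ∈ D i ∧ c.2 ∈ D' i}.Finite :=
  ((finite_alphabet D).prod (finite_alphabet D')).subset fun _ ⟨i, h⟩ => ⟨⟨i, h.1⟩, ⟨i, h.2⟩⟩

theorem converter_isFinite {β : Fin p → ℝ} (hPisot : IsPisot (∏ i, β i))
    (hmem : ∀ i, β i ∈ IntermediateField.adjoin ℚ {∏ k, β k}) (D D' : Fin p → Finset ℤ) :
    (converter β D D').IsFinite := by
  refine ⟨?_, finite_pair_alphabet D D'⟩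
  have hfin := Set.finite_iUnion fun i => (finite_altSpectrum_inter hPisot hmem
    (diffAlphabet D D') i (max |upper β (diffAlphabet D D') i|
      |lower β (diffAlphabet D D') i|)).image (Prod.mk i)
  refine hfin.subset ?_
  rintro ⟨i, s⟩ ⟨hs, h1, h2⟩
  refine Set.mem_iUnion.2 ⟨i, s, ⟨hs, ?_⟩, rfl⟩
  rw [abs_le]
  dsimp only at h1 h2
  constructor
  · linarith [le_abs_self (upper β (diffAlphabet D D') i),
      le_max_left |upper β (diffAlphabet D D') i| |lower β (diffAlphabet D D') i|]
  · linarith [neg_abs_le (lower β (diffAlphabet D D') i),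
      le_max_right |upper β (diffAlphabet D D') i| |lower β (diffAlphabet D D') i|]

/-! ### The automaton of greedy expansions -/

/-- Index in `{0, …, m + n - 1}` of the position `k` of a word with preperiod `m` and period `n`. -/
def wrap (m n : ℕ) : ℕ → ℕ
  | 0 => 0
  | k + 1 => if wrap m n k + 1 < m + n then wrap m n k + 1 else m

theorem wrap_lt {m n : ℕ} (hn : 1 ≤ n) (k : ℕ) : wrap m n k < m + n := by
  cases k with
  | zero => simp [wrap]; omega
  | succ k => rw [wrap]; split_ifs <;> omega

theorem wrap_eq_zero {m n : ℕ} (hm : 1 ≤ m) {k : ℕ} (h : wrap m n k = 0) : k = 0 := by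
  cases k with
  | zero => rfl
  | succ k => rw [wrap] at h; split_ifs at h; omega

/-- The second clause records that whole periods are removed only beyond the preperiod, where this
does not change the letter. -/
theorem exists_eq_wrap_add {m n : ℕ} (hn : 1 ≤ n) (k : ℕ) :
    ∃ c, k = wrap m n k + c * n ∧ (c = 0 ∨ m ≤ wrap m n k) := by
  induction k with
  | zero => exact ⟨0, by simp [wrap]⟩
  | succ k ih =>
    obtain ⟨c, hc, h⟩ := ih
    have hlt := wrap_lt (m := m) hn k
    rw [wrap]
    split_ifs with hif
    · exact ⟨c, by omega, by omega⟩
    · exact ⟨c + 1, by rw [add_mul]; omega, Or.inr le_rfl⟩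

theorem HasPeriod.apply_wrap {t : ℕ → ℤ} {m n : ℕ} (h : HasPeriod t m n) (k : ℕ) :
    t (wrap m n k) = t k := by
  obtain ⟨c, hc, h0⟩ := exists_eq_wrap_add (m := m) h.2.1 k
  have hper : ∀ w c, m ≤ w → t (w + c * n) = t w := fun w c hw => by
    induction c with
    | zero => simp
    | succ c ih => rw [add_mul, one_mul, ← add_assoc, h.2.2 _ (hw.trans (Nat.le_add_right _ _)), ih]
  rcases h0 with rfl | h0
  · congr 1
    omega
  · conv_rhs => rw [hc]
    exact (hper _ c h0).symm

/-- The last position up to `n` at which the comparison of `v` with the words `t^{(i)}` restarts. -/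
def lastReset (t : Fin p → ℕ → ℤ) (v : ℕ → ℤ) : ℕ → ℕ
  | 0 => 0
  | n + 1 =>
    if v n = t (Fin.ofNat p (lastReset t v n)) (n - lastReset t v n) then lastReset t v n
    else n + 1

/-- The digit with which `v n` is compared. -/
def pivot (t : Fin p → ℕ → ℤ) (v : ℕ → ℤ) (n : ℕ) : ℤ :=
  t (Fin.ofNat p (lastReset t v n)) (n - lastReset t v n)

theorem lastReset_succ_of_eq {t : Fin p → ℕ → ℤ} {v : ℕ → ℤ} {n : ℕ} (h : v n = pivot t v n) :
    lastReset t v (n + 1) = lastReset t v n := by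
  rw [pivot] at h
  rw [lastReset, if_pos h]

theorem lastReset_succ_of_ne {t : Fin p → ℕ → ℤ} {v : ℕ → ℤ} {n : ℕ} (h : v n ≠ pivot t v n) :
    lastReset t v (n + 1) = n + 1 := by
  rw [pivot] at h
  rw [lastReset, if_neg h]

theorem lastReset_le (t : Fin p → ℕ → ℤ) (v : ℕ → ℤ) (n : ℕ) : lastReset t v n ≤ n := by
  induction n with
  | zero => simp [lastReset]
  | succ n ih => rw [lastReset]; split_ifs <;> omega

/-- The state reached after `n` letters of `v`. -/
def runState (t : Fin p → ℕ → ℤ) (m n : Fin p → ℕ) (v : ℕ → ℤ) (N : ℕ) : Fin p × Fin p × ℕ :=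
  (Fin.ofNat p (lastReset t v N), Fin.ofNat p N,
    wrap (m (Fin.ofNat p (lastReset t v N))) (n (Fin.ofNat p (lastReset t v N)))
      (N - lastReset t v N))

theorem runState_succ_of_eq {t : Fin p → ℕ → ℤ} {m n : Fin p → ℕ} {v : ℕ → ℤ} {N : ℕ}
    (h : v N = pivot t v N) : runState t m n v (N + 1) = advance m n (runState t m n v N) := by
  have hle := lastReset_le t v N
  rw [runState, lastReset_succ_of_eq h, advance, runState,
    show N + 1 - lastReset t v N = (N - lastReset t v N) + 1 by omega, wrap, ofNat_succ]

theorem runState_succ_of_ne {t : Fin p → ℕ → ℤ} {m n : Fin p → ℕ} {v : ℕ → ℤ} {N : ℕ}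
    (h : v N ≠ pivot t v N) : runState t m n v (N + 1) =
      ((runState t m n v N).2.1 + 1, (runState t m n v N).2.1 + 1, 0) := by
  rw [runState, lastReset_succ_of_ne h, runState, Nat.sub_self, wrap, ofNat_succ]

theorem pivot_eq_runState {t : Fin p → ℕ → ℤ} {m n : Fin p → ℕ}
    (hper : ∀ i, HasPeriod (t i) (m i) (n i)) (v : ℕ → ℤ) (N : ℕ) :
    t (runState t m n v N).1 (runState t m n v N).2.2 = pivot t v N :=
  (hper _).apply_wrap _

/-- The automaton is deterministic: the two kinds of transition carry disjoint labels, equal to the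
pivot or below it. -/
theorem eq_runState {β : Fin p → ℝ} {t : Fin p → ℕ → ℤ} {m n : Fin p → ℕ}
    (hper : ∀ i, HasPeriod (t i) (m i) (n i)) {v : ℕ → ℤ} {q : ℕ → Fin p × Fin p × ℕ}
    (h0 : q 0 ∈ (greedyAutomaton β t m n).init)
    (hq : ∀ N, (q N, v N, q (N + 1)) ∈ (greedyAutomaton β t m n).trans) (N : ℕ) :
    q N = runState t m n v N := by
  induction N with
  | zero => rw [h0.1]; rfl
  | succ N ih =>
    have h := (hq N).2.2.2
    simp only [ih, pivot_eq_runState hper] at h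
    rcases h with ⟨h1, h2⟩ | ⟨h1, h2⟩
    · rw [h2, runState_succ_of_eq h1]
    · rw [h2, runState_succ_of_ne h1.ne]

theorem runState_mem_final {β : Fin p → ℝ} {t : Fin p → ℕ → ℤ} {m n : Fin p → ℕ}
    (hper : ∀ i, HasPeriod (t i) (m i) (n i)) (v : ℕ → ℤ) (N : ℕ) :
    runState t m n v N ∈ (greedyAutomaton β t m n).final ↔ lastReset t v N = N := by
  constructor
  · rintro ⟨⟨-, h⟩, -⟩
    -- Since the preperiod is non-empty, the cycle never returns to index 0; only a restart does.
    have := wrap_eq_zero (hper _).1 h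
    have := lastReset_le t v N
    omega
  · intro h
    refine ⟨?_, wrap_lt (hper _).2.1 _⟩
    rw [runState, h, Nat.sub_self]
    exact ⟨rfl, rfl⟩

/-- A restart at `N + 1` is precisely a mismatch at `N`; the restart at 0 is irrelevant to
recurrence. -/
theorem frequently_lastReset_eq_iff (t : Fin p → ℕ → ℤ) (v : ℕ → ℤ) :
    (∃ᶠ N in Filter.atTop, lastReset t v N = N) ↔ ∃ᶠ N in Filter.atTop, v N ≠ pivot t v N := by
  rw [Filter.frequently_atTop, Filter.frequently_atTop]
  constructor
  · intro h a
    obtain ⟨b, hab, hb⟩ := h (a + 1)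
    obtain ⟨b, rfl⟩ : ∃ b', b = b' + 1 := ⟨b - 1, by omega⟩
    refine ⟨b, by omega, fun hne => ?_⟩
    rw [lastReset_succ_of_eq hne] at hb
    have := lastReset_le t v b
    omega
  · intro h a
    obtain ⟨b, hab, hb⟩ := h a
    exact ⟨b + 1, by omega, lastReset_succ_of_ne hb⟩

theorem mem_greedyAutomaton_language {β : Fin p → ℝ} {t : Fin p → ℕ → ℤ} {m n : Fin p → ℕ}
    (hper : ∀ i, HasPeriod (t i) (m i) (n i)) {v : ℕ → ℤ} :
    v ∈ (greedyAutomaton β t m n).language ↔ (∀ N, ∃ i, v N ∈ greedyAlphabet β i) ∧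
      (∀ N, v N ≤ pivot t v N) ∧ ∃ᶠ N in Filter.atTop, v N ≠ pivot t v N := by
  constructor
  · rintro ⟨q, h0, hq, hf⟩
    obtain rfl : q = runState t m n v := funext (eq_runState hper h0 hq)
    simp only [runState_mem_final hper, frequently_lastReset_eq_iff] at hf
    refine ⟨fun N => (hq N).2.1, fun N => ?_, hf⟩
    have h := (hq N).2.2.2
    simp only [pivot_eq_runState hper] at h
    rcases h with h | h
    · exact h.1.le
    · exact h.1.le
  · rintro ⟨h1, h2, h3⟩
    have hlt : ∀ N, (runState t m n v N).2.2 <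
        m (runState t m n v N).1 + n (runState t m n v N).1 := fun N => wrap_lt (hper _).2.1 _
    refine ⟨runState t m n v, ⟨rfl, hlt 0⟩, fun N => ⟨hlt N, h1 N, hlt (N + 1), ?_⟩, ?_⟩
    · simp only [pivot_eq_runState hper]
      rcases (h2 N).eq_or_lt with h | h
      · exact Or.inl ⟨h, runState_succ_of_eq h⟩
      · exact Or.inr ⟨h, runState_succ_of_ne h.ne⟩
    · simpa only [runState_mem_final hper, frequently_lastReset_eq_iff] using h3

/-- The automaton of greedy expansions tests a letter only against the union of the alphabets. Along
a run its second component is the position modulo `p`, which lets the pair automaton test the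
alphabets position by position. -/
theorem greedyPairAutomaton_language {β : Fin p → ℝ} {t : Fin p → ℕ → ℤ} {m n : Fin p → ℕ}
    (hper : ∀ i, HasPeriod (t i) (m i) (n i)) (D : Fin p → Finset ℤ) :
    (greedyPairAutomaton β D t m n).language =
      {w | w ∈ pairWords D (greedyAlphabet β) ∧
        (fun N => (w N).2) ∈ (greedyAutomaton β t m n).language} := by
  ext w
  constructor
  · rintro ⟨q, h0, hq, hf⟩
    refine ⟨fun N => ?_, q, h0, fun N => (hq N).2.2, hf⟩
    have hN := eq_runState (v := fun N => (w N).2) hper h0 (fun N => (hq N).2.2) N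
    have h1 := (hq N).1
    have h2 := (hq N).2.1
    simp only [hN] at h1 h2
    exact ⟨h1, h2⟩
  · rintro ⟨hw, q, h0, hq, hf⟩
    refine ⟨q, h0, fun N => ?_, hf⟩
    have hN := eq_runState hper h0 hq N
    have hpos : (q N).2.1 = Fin.ofNat p N := by rw [hN]; rfl
    refine ⟨?_, ?_, hq N⟩ <;> simp only [hpos]
    · exact (hw N).1
    · exact (hw N).2

theorem greedyAutomaton_isFinite (β : Fin p → ℝ) (t : Fin p → ℕ → ℤ) (m n : Fin p → ℕ) :
    (greedyAutomaton β t m n).IsFinite := by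
  refine ⟨?_, finite_alphabet (greedyAlphabet β)⟩
  have hfin := Set.finite_iUnion fun i : Fin p => (Set.finite_singleton i).prod
    ((Set.finite_univ (α := Fin p)).prod (Set.finite_lt_nat (m i + n i)))
  refine hfin.subset ?_
  rintro ⟨i, j, k⟩ h
  exact Set.mem_iUnion.2 ⟨i, rfl, trivial, h⟩

theorem greedyPairAutomaton_isFinite (β : Fin p → ℝ) (D : Fin p → Finset ℤ)
    (t : Fin p → ℕ → ℤ) (m n : Fin p → ℕ) : (greedyPairAutomaton β D t m n).IsFinite :=
  ⟨(greedyAutomaton_isFinite β t m n).1, finite_pair_alphabet D (greedyAlphabet β)⟩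

/-! ### Characterization of greedy expansions -/

/-- The quasi-greedy expansions of `1` in all cyclic shifts of the base. -/
noncomputable def quasiGreedy (β : Fin p → ℝ) (i : Fin p) : ℕ → ℤ := qdig (cyc (shift β i))

/-- The remainder of the quasi-greedy expansion with which `v` is compared at position `n`. -/
noncomputable def pivotRem (β : Fin p → ℝ) (v : ℕ → ℤ) (n : ℕ) : ℝ :=
  qrem (cyc (shift β (Fin.ofNat p (lastReset (quasiGreedy β) v n))))
    (n - lastReset (quasiGreedy β) v n)

theorem cyc_shift_lastReset (β : Fin p → ℝ) (t : Fin p → ℕ → ℤ) (v : ℕ → ℤ) (n : ℕ) :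
    cyc (shift β (Fin.ofNat p (lastReset t v n))) (n - lastReset t v n) = cyc β n := by
  rw [cyc_shift, Nat.sub_add_cancel (lastReset_le t v n)]

theorem pivot_eq_ceil (β : Fin p → ℝ) (v : ℕ → ℤ) (n : ℕ) :
    pivot (quasiGreedy β) v n = ⌈cyc β n * pivotRem β v n⌉ - 1 := by
  rw [pivot, quasiGreedy, qdig, cyc_shift_lastReset, pivotRem]

theorem pivotRem_zero (β : Fin p → ℝ) (v : ℕ → ℤ) : pivotRem β v 0 = 1 := by
  simp [pivotRem, lastReset, qrem]

theorem pivotRem_succ_of_eq {β : Fin p → ℝ} {v : ℕ → ℤ} {n : ℕ}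
    (h : v n = pivot (quasiGreedy β) v n) :
    pivotRem β v (n + 1) = cyc β n * pivotRem β v n - pivot (quasiGreedy β) v n := by
  have hle := lastReset_le (quasiGreedy β) v n
  rw [pivotRem, lastReset_succ_of_eq h,
    show n + 1 - lastReset (quasiGreedy β) v n = (n - lastReset (quasiGreedy β) v n) + 1 by omega,
    qrem_succ, cyc_shift_lastReset]
  rfl

theorem pivotRem_succ_of_ne {β : Fin p → ℝ} {v : ℕ → ℤ} {n : ℕ}
    (h : v n ≠ pivot (quasiGreedy β) v n) : pivotRem β v (n + 1) = 1 := by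
  rw [pivotRem, lastReset_succ_of_ne h, Nat.sub_self, qrem]

theorem pivotRem_mem_Ioc (β : Fin p → ℝ) (v : ℕ → ℤ) (n : ℕ) :
    pivotRem β v n ∈ Set.Ioc (0 : ℝ) 1 := ⟨qrem_pos _ _, qrem_le_one _ _⟩

/-- A strict inequality `y < z` gives `⌊y⌋ ≤ ⌈z⌉ - 1`, whence the digit bound. Equal digits preserve
the strict inequality of remainders, and after a mismatch the pivot remainder is reset to 1, above
every greedy remainder. -/
theorem greedy_le_pivot {β : Fin p → ℝ} (hβ : ∀ i, 1 < β i) {x : ℝ} (hx : x ∈ Set.Ico (0 : ℝ) 1)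
    (n : ℕ) : rem β x n < pivotRem β (greedy β x) n ∧
      greedy β x n ≤ pivot (quasiGreedy β) (greedy β x) n := by
  have hdig : ∀ n, rem β x n < pivotRem β (greedy β x) n →
      greedy β x n ≤ pivot (quasiGreedy β) (greedy β x) n := fun n h => by
    rw [pivot_eq_ceil, Int.le_sub_one_iff, Int.lt_ceil]
    exact (Int.floor_le _).trans_lt (mul_lt_mul_of_pos_left h (zero_lt_one.trans (hβ _)))
  suffices h : rem β x n < pivotRem β (greedy β x) n from ⟨h, hdig n h⟩
  induction n with
  | zero => rw [pivotRem_zero]; exact hx.2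
  | succ n ih =>
    by_cases h : greedy β x n = pivot (quasiGreedy β) (greedy β x) n
    · rw [pivotRem_succ_of_eq h, rem_succ, ← h]
      exact sub_lt_sub_right (mul_lt_mul_of_pos_left ih (zero_lt_one.trans (hβ _))) _
    · rw [pivotRem_succ_of_ne h]
      exact (rem_mem_Ico β hx _).2

/-- With no more mismatches, the positive gap between the two remainders would expand by a factor at
least `c` forever, although it never exceeds 1. -/
theorem frequently_greedy_ne_pivot {β : Fin p → ℝ} (hβ : ∀ i, 1 < β i) {x : ℝ}
    (hx : x ∈ Set.Ico (0 : ℝ) 1) :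
    ∃ᶠ n in Filter.atTop, greedy β x n ≠ pivot (quasiGreedy β) (greedy β x) n := by
  obtain ⟨c, hc, hb⟩ := exists_lower_bound hβ
  rw [Filter.frequently_atTop]
  by_contra! hno
  obtain ⟨N, hN⟩ := hno
  obtain ⟨n, -, hn⟩ := not_bounded_of_expanding hc
    (g := fun n => pivotRem β (greedy β x) n - rem β x n) (N := N)
    (sub_pos.2 (greedy_le_pivot hβ hx N).1) (fun n hn hpos => by
      rw [pivotRem_succ_of_eq (hN n hn), rem_succ, ← hN n hn]
      nlinarith [mul_le_mul_of_nonneg_right (hb n) hpos.le]) 1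
  have h1 := (pivotRem_mem_Ioc β (greedy β x) n).2
  have h2 := (rem_mem_Ico β hx n).1
  linarith

/-- If the gap `g` were ever nonnegative it would remain so. The next mismatch would make it
positive, and from then on it would grow without bound, contradicting the bound on tails. Recurrence
of mismatches is what excludes the case of equality. -/
theorem tail_lt_pivotRem {β : Fin p → ℝ} (hβ : ∀ i, 1 < β i) {v : ℕ → ℤ} {C : ℝ}
    (hC : ∀ n, |(v n : ℝ)| ≤ C) (hle : ∀ n, v n ≤ pivot (quasiGreedy β) v n)
    (hne : ∃ᶠ n in Filter.atTop, v n ≠ pivot (quasiGreedy β) v n) (n : ℕ) :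
    tail (cyc β) v n < pivotRem β v n := by
  obtain ⟨c, hc, hb⟩ := exists_lower_bound hβ
  obtain ⟨B, hB⟩ := exists_abs_tail_le hc hb hC
  let g : ℕ → ℝ := fun n => tail (cyc β) v n - pivotRem β v n
  have hstep : ∀ n, cyc β n * g n ≤ g (n + 1) ∧
      (v n ≠ pivot (quasiGreedy β) v n → cyc β n * g n < g (n + 1)) := by
    intro n
    have ht := tail_succ hc hb hC n
    by_cases h : v n = pivot (quasiGreedy β) v n
    · refine ⟨le_of_eq ?_, fun h' => absurd h h'⟩
      simp only [g]
      rw [pivotRem_succ_of_eq h, ht, ← h]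
      ring
    -- The digit deficit is at least 1, which pays for the reset of the pivot remainder to 1;
    -- strictness comes from the ceiling in the pivot.
    · have hlt : (v n : ℝ) + 1 ≤ pivot (quasiGreedy β) v n := by
        exact_mod_cast (hle n).lt_of_ne h
      have hceil : (pivot (quasiGreedy β) v n : ℝ) < cyc β n * pivotRem β v n := by
        rw [pivot_eq_ceil, ← Int.lt_ceil]
        omega
      have : cyc β n * g n < g (n + 1) := by
        simp only [g]
        rw [pivotRem_succ_of_ne h, ht]
        linarith
      exact ⟨this.le, fun _ => this⟩
  by_contra! hn
  have hnonneg : ∀ k, 0 ≤ g (n + k) := by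
    intro k
    induction k with
    | zero => exact sub_nonneg.2 hn
    | succ k ih =>
      exact (mul_nonneg (zero_le_one.trans (hβ _).le) ih).trans (hstep (n + k)).1
  obtain ⟨N, hnN, hN⟩ := (Filter.frequently_atTop.1 hne) n
  have hgN : 0 ≤ g N := by simpa [Nat.add_sub_cancel' hnN] using hnonneg (N - n)
  have hpos : 0 < g (N + 1) :=
    (mul_nonneg (zero_le_one.trans (hβ _).le) hgN).trans_lt ((hstep N).2 hN)
  obtain ⟨k, -, hk⟩ := not_bounded_of_expanding hc hpos (fun k _ hk =>
    (mul_le_mul_of_nonneg_right (hb k) hk.le).trans (hstep k).1) B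
  have h1 := (pivotRem_mem_Ioc β v k).1
  have h2 := (le_abs_self _).trans (hB k)
  simp only [g] at hk
  linarith

theorem greedyAutomaton_language {β : Fin p → ℝ} (hβ : ∀ i, 1 < β i) {m n : Fin p → ℕ}
    (hper : ∀ i, HasPeriod (quasiGreedy β i) (m i) (n i)) :
    (greedyAutomaton β (quasiGreedy β) m n).language =
      {v | ∃ x ∈ Set.Ico (0 : ℝ) 1, v = greedy β x} := by
  obtain ⟨c, hc, hb⟩ := exists_lower_bound hβ
  obtain ⟨C, hC⟩ := exists_digit_bound (greedyAlphabet β)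
  ext v
  rw [mem_greedyAutomaton_language hper]
  constructor
  · rintro ⟨h1, h2, h3⟩
    have hv : ∀ n, |(v n : ℝ)| ≤ C := fun n => by
      obtain ⟨i, hi⟩ := h1 n
      exact hC i _ hi
    have hv0 : ∀ n, 0 ≤ v n := fun n => by
      obtain ⟨i, hi⟩ := h1 n
      exact (Finset.mem_Icc.1 hi).1
    have htail : ∀ n, tail (cyc β) v n ∈ Set.Ico (0 : ℝ) 1 := fun n =>
      ⟨cantorVal_nonneg hc (fun k => hb (k + n)) fun k => hv0 (k + n),
        (tail_lt_pivotRem hβ hv h2 h3 n).trans_le (pivotRem_mem_Ioc β v n).2⟩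
    exact ⟨val β v, htail 0, eq_greedy_of_tail_mem hβ hv htail⟩
  · rintro ⟨x, hx, rfl⟩
    exact ⟨fun n => ⟨_, greedy_mem hβ hx n⟩, fun n => (greedy_le_pivot hβ hx n).2,
      frequently_greedy_ne_pivot hβ hx⟩

/-! ### Product of the two automata and the main theorem -/

omit [NeZero p] in
theorem zero_mem_greedyAlphabet {β : Fin p → ℝ} (hβ : ∀ i, 1 < β i) (i : Fin p) :
    (0 : ℤ) ∈ greedyAlphabet β i := by
  have : 0 < ⌈β i⌉ := Int.ceil_pos.2 (zero_lt_one.trans (hβ i))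
  exact Finset.mem_Icc.2 ⟨le_rfl, by omega⟩

/-- The alphabets of the converter may be enlarged, so that they contain `0`. -/
theorem inter_language {β : Fin p → ℝ} (hβ : ∀ i, 1 < β i) {D D₀ : Fin p → Finset ℤ}
    (hsub : ∀ i, D i ⊆ D₀ i) (hD₀ : ∀ i, 0 ∈ D₀ i) {m n : Fin p → ℕ}
    (hper : ∀ i, HasPeriod (quasiGreedy β i) (m i) (n i)) :
    ((converter β D₀ (greedyAlphabet β)).inter
      (greedyPairAutomaton β D (quasiGreedy β) m n)).language = normalizationPairs β D := by
  rw [BuchiAutomaton.language_inter, converter_language hβ hD₀ (zero_mem_greedyAlphabet hβ),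
    greedyPairAutomaton_language hper, greedyAutomaton_language hβ hper]
  ext w
  constructor
  -- The converter's own alphabet condition is dropped: membership in `D` is enforced by the pair
  -- automaton.
  · rintro ⟨⟨-, h1⟩, h2, h3⟩
    exact ⟨h2, h1, h3⟩
  · rintro ⟨h1, h2, h3⟩
    exact ⟨⟨fun N => ⟨hsub _ (h1 N).1, (h1 N).2⟩, h2⟩, h1, h3⟩

end AlternateBase

theorem mainTheorem7 {p : ℕ} [NeZero p] (β : Fin p → ℝ) (hβ : ∀ i, 1 < β i)
    (hPisot : AlternateBase.IsPisot (∏ i, β i))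
    (hmem : ∀ i, β i ∈ IntermediateField.adjoin ℚ {∏ k, β k})
    (D : Fin p → Finset ℤ) :
    -- the pairs to be accepted form the graph of the normalization function
    AlternateBase.normalizationPairs β D =
        {w | (fun n => (w n).2) ∈ AlternateBase.normalization β D (fun n => (w n).1)} ∧
    -- normalization is computable by a finite automaton
    AlternateBase.NormalizationComputable β D ∧
    -- explicit construction: the quasi-greedy expansions of 1 exist and are eventually periodic
    ∃ t : Fin p → ℕ → ℤ,
      (∀ i, AlternateBase.IsQuasiGreedy (AlternateBase.shift β i) (t i)) ∧
      (∀ i, ∃ m n, AlternateBase.HasPeriod (t i) m n) ∧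
      ∀ m n : Fin p → ℕ, (∀ i, AlternateBase.HasPeriod (t i) (m i) (n i)) →
        -- the automata of greedy expansions
        ((AlternateBase.greedyAutomaton β t m n).IsFinite ∧
          (AlternateBase.greedyAutomaton β t m n).language =
            {v | ∃ x ∈ Set.Ico (0 : ℝ) 1, v = AlternateBase.greedy β x}) ∧
        ((AlternateBase.greedyPairAutomaton β D t m n).IsFinite ∧
          (AlternateBase.greedyPairAutomaton β D t m n).language =
            {w | w ∈ AlternateBase.pairWords D (AlternateBase.greedyAlphabet β) ∧
              ∃ x ∈ Set.Ico (0 : ℝ) 1, (fun n => (w n).2) = AlternateBase.greedy β x}) ∧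
        -- the converter and the intersection
        ((∀ i, (0 : ℤ) ∈ D i) →
          ((AlternateBase.converter β D (AlternateBase.greedyAlphabet β)).IsFinite ∧
            (AlternateBase.converter β D (AlternateBase.greedyAlphabet β)).language =
              {w | w ∈ AlternateBase.pairWords D (AlternateBase.greedyAlphabet β) ∧
                AlternateBase.val β (fun n => (w n).1) =
                  AlternateBase.val β (fun n => (w n).2)}) ∧
          (((AlternateBase.converter β D (AlternateBase.greedyAlphabet β)).inter
              (AlternateBase.greedyPairAutomaton β D t m n)).IsFinite ∧
            ((AlternateBase.converter β D (AlternateBase.greedyAlphabet β)).inter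
              (AlternateBase.greedyPairAutomaton β D t m n)).language =
              AlternateBase.normalizationPairs β D)) := by
  have h0 : ∀ i, (0 : ℤ) ∈ AlternateBase.greedyAlphabet β i := fun i =>
    AlternateBase.zero_mem_greedyAlphabet hβ i
  have hperiod : ∀ i, ∃ m n, AlternateBase.HasPeriod (AlternateBase.quasiGreedy β i) m n :=
    fun i => AlternateBase.exists_hasPeriod_qdig (β := AlternateBase.shift β i) (fun _ => hβ _)
      (by rwa [AlternateBase.prod_shift])
      (fun j => by rw [AlternateBase.prod_shift]; exact hmem _)
  refine ⟨AlternateBase.normalizationPairs_eq_graph hβ D, ?_, AlternateBase.quasiGreedy β,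
    fun i => AlternateBase.isQuasiGreedy_qdig fun _ => hβ _, hperiod, fun m n hper => ?_⟩
  · choose m n hper using hperiod
    -- Adjoining 0 to the converter's alphabets makes zero padding possible for arbitrary `D`,
    -- without enlarging the intersection.
    refine ⟨_, (AlternateBase.converter β (fun i => insert 0 (D i))
      (AlternateBase.greedyAlphabet β)).inter (AlternateBase.greedyPairAutomaton β D
        (AlternateBase.quasiGreedy β) m n),
      (AlternateBase.converter_isFinite hPisot hmem _ _).inter
        (AlternateBase.greedyPairAutomaton_isFinite _ _ _ _ _),
      AlternateBase.inter_language hβ (fun i => Finset.subset_insert _ _)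
        (fun i => Finset.mem_insert_self _ _) hper⟩
  · refine ⟨⟨AlternateBase.greedyAutomaton_isFinite _ _ _ _,
      AlternateBase.greedyAutomaton_language hβ hper⟩,
      ⟨AlternateBase.greedyPairAutomaton_isFinite _ _ _ _ _, ?_⟩, fun hD =>
      ⟨⟨AlternateBase.converter_isFinite hPisot hmem _ _,
        AlternateBase.converter_language hβ hD h0⟩,
      (AlternateBase.converter_isFinite hPisot hmem _ _).inter
        (AlternateBase.greedyPairAutomaton_isFinite _ _ _ _ _),
      AlternateBase.inter_language hβ (fun i => subset_rfl) hD hper⟩⟩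
    rw [AlternateBase.greedyPairAutomaton_language hper,
      AlternateBase.greedyAutomaton_language hβ hper]
    rfl
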